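/- Let $R$ be a commutative ring with unit and let $I\subseteq R$ be an ideal generated by a finite regular sequence $r_1,\dots,r_n$ (that is, $r_i$ is a non-zero divisor on $R/(r_1,\dots,r_{i-1})$ for each $i$, and $R/(r_1,\dots,r_n)\neq 0$). Write $\operatorname{Tor}_*=\operatorname{Tor}^R_*$, with $\operatorname{Tor}_{-1}=0$ and $I^0=R$. For $s\ge 0$ let $p\colon I^s\to I^s/I^{s+1}$ be the projection and let $$\partial\colon \operatorname{Tor}_{k}(R/I,\,I^s/I^{s+1})\longrightarrow \operatorname{Tor}_{k-1}(R/I,\,I^{s+1}/I^{s+2})$$ be the connecting homomorphism associated to the short exact sequence $0\to I^{s+1}/I^{s+2}\to I^s/I^{s+2}\to I^s/I^{s+1}\to 0$. 1. For every $s\ge 0$ and every $k\ge 0$ the sequence $$0\longrightarrow \operatorname{Tor}_k(R/I,\,I^s)\xrightarrow{\;p_*\;}\operatorname{Tor}_k(R/I,\,I^s/I^{s+1})\xrightarrow{\;\partial\;}\operatorname{Tor}_{k-1}(R/I,\,I^{s+1}/I^{s+2})$$ is exact. 2. For every $s\ge 0$ and every $k\ge 0$ the $R/I$-module $\operatorname{Tor}_k(R/I,\,I^s)$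 is free. 3. For every $s\ge 1$ the product $\operatorname{Tor}_i(R/I,I^s)\otimes_R\operatorname{Tor}_j(R/I,I^s)\to\operatorname{Tor}_{i+j}(R/I,I^s)$ induced by the multiplications of $R/I$ and of the (non-unital) $R$-algebra $I^s$ is zero for all $i,j\ge 0$. -/

import Mathlib

universe u
noncomputable section

open CategoryTheory CategoryTheory.Limits CategoryTheory.MonoidalCategory
open scoped TensorProduct

namespace IdealTor

variable {R : Type u} [CommRing R]

/-- `Tor_k(M, N)`: Mathlib's `Tor'`, the `k`-th left derived functor of `- ⊗ N`, at `M`. -/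
abbrev tor (k : ℕ) (M N : ModuleCat.{u} R) : ModuleCat.{u} R :=
  ((Tor' (ModuleCat.{u} R) k).obj M).obj N

/-- The map `Tor_k(M, N) ⟶ Tor_k(M, N')` induced by `f : N ⟶ N'`. -/
abbrev torMap (k : ℕ) (M : ModuleCat.{u} R) {N N' : ModuleCat.{u} R} (f : N ⟶ N') :
    tor k M N ⟶ tor k M N' :=
  ((Tor' (ModuleCat.{u} R) k).obj M).map f

/-- The (chosen) projective resolution `P` of `M`. -/
abbrev resolution (M : ModuleCat.{u} R) : ChainComplex (ModuleCat.{u} R) ℕ :=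
  (projectiveResolution M).complex

/-- The complex `P ⊗ N`, where `P` is the projective resolution of `M`. -/
abbrev torComplex (M N : ModuleCat.{u} R) : ChainComplex (ModuleCat.{u} R) ℕ :=
  (((tensoringRight (ModuleCat.{u} R)).obj N).mapHomologicalComplex _).obj (resolution M)

/-- The chain map `P ⊗ N ⟶ P ⊗ N'` induced by `f : N ⟶ N'`. -/
abbrev torComplexMap (M : ModuleCat.{u} R) {N N' : ModuleCat.{u} R} (f : N ⟶ N') :
    torComplex M N ⟶ torComplex M N' :=
  (NatTrans.mapHomologicalComplex ((tensoringRight (ModuleCat.{u} R)).map f) _).app (resolution M)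

/-- `Tor_k(M, N)` is the homology of `P ⊗ N`; the isomorphism is natural in `N`. -/
def torIso (k : ℕ) (M N : ModuleCat.{u} R) : tor k M N ≅ (torComplex M N).homology k :=
  (projectiveResolution M).isoLeftDerivedObj ((tensoringRight (ModuleCat.{u} R)).obj N) k

instance (M : ModuleCat.{u} R) (i : ℕ) : Module.Projective R ((resolution M).X i) :=
  inferInstance

instance (M : ModuleCat.{u} R) (i : ℕ) : Module.Flat R ((resolution M).X i) :=
  inferInstance

/-- The sequence of complexes `P ⊗ S.X₁ ⟶ P ⊗ S.X₂ ⟶ P ⊗ S.X₃` attached to a sequence `S` of modules. -/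
def torShortComplex (M : ModuleCat.{u} R) (S : ShortComplex (ModuleCat.{u} R)) :
    ShortComplex (ChainComplex (ModuleCat.{u} R) ℕ) :=
  ShortComplex.mk (torComplexMap M S.f) (torComplexMap M S.g) (by
    ext i : 1
    change ((resolution M).X i ◁ S.f) ≫ ((resolution M).X i ◁ S.g) = 0
    rw [← MonoidalCategory.whiskerLeft_comp, S.zero, MonoidalPreadditive.whiskerLeft_zero])

lemma torShortComplex_shortExact (M : ModuleCat.{u} R) {S : ShortComplex (ModuleCat.{u} R)}
    (hS : S.ShortExact) : (torShortComplex M S).ShortExact := by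
  refine HomologicalComplex.shortExact_of_degreewise_shortExact _ fun i => ?_
  have hf : Function.Injective S.f.hom := hS.moduleCat_injective_f
  have hg : Function.Surjective S.g.hom := hS.moduleCat_surjective_g
  exact
    { exact := Module.Flat.lTensor_shortComplex_exact ((resolution M).X i) S hS.exact
      mono_f := (ModuleCat.mono_iff_injective _).2
        (Module.Flat.lTensor_preserves_injective_linearMap (M := (resolution M).X i) S.f.hom hf)
      epi_g := (ModuleCat.epi_iff_surjective _).2
        (LinearMap.lTensor_surjective ((resolution M).X i) hg) }

/-- The connecting homomorphism `Tor_{k+1}(M, S.X₃) ⟶ Tor_k(M, S.X₁)` of a short exact sequence `S`,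
that is, the connecting homomorphism of the short exact sequence of complexes `P ⊗ S`. -/
def torδ (k : ℕ) (M : ModuleCat.{u} R) {S : ShortComplex (ModuleCat.{u} R)}
    (hS : S.ShortExact) : tor (k + 1) M S.X₃ ⟶ tor k M S.X₁ :=
  (torIso (k + 1) M S.X₃).hom ≫
    (torShortComplex_shortExact M hS).δ (k + 1) k (by simp) ≫ (torIso k M S.X₁).inv

lemma homologyFunctor_map_smul_id (K : ChainComplex (ModuleCat.{u} R) ℕ) (k : ℕ) (r : R) :
    (HomologicalComplex.homologyFunctor (ModuleCat.{u} R) (ComplexShape.down ℕ) k).map (r • 𝟙 K) =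
      r • 𝟙 (K.homology k) := by
  have h : HomologicalComplex.homologyMap (r • 𝟙 K) k =
      r • HomologicalComplex.homologyMap (𝟙 K) k :=
    ShortComplex.homologyMap_smul
      ((HomologicalComplex.shortComplexFunctor (ModuleCat.{u} R) _ k).map (𝟙 K)) r
  rw [HomologicalComplex.homologyMap_id] at h
  exact h

lemma leftDerived_map_smul_id (M N : ModuleCat.{u} R) (k : ℕ) (r : R) :
    (((tensoringRight (ModuleCat.{u} R)).obj N).leftDerived k).map (r • 𝟙 M) = r • 𝟙 _ := by
  have h : (((tensoringRight (ModuleCat.{u} R)).obj N).mapHomologicalComplex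
      (ComplexShape.down ℕ)).map (r • 𝟙 (projectiveResolution M).complex) =
        r • 𝟙 (torComplex M N) := by
    ext i : 1
    change ((r • 𝟙 ((projectiveResolution M).complex.X i)) ▷ N : _) = r • 𝟙 _
    rw [MonoidalLinear.smul_whiskerRight, MonoidalCategory.id_whiskerRight]
    rfl
  rw [Functor.leftDerived_map_eq _ k (r • 𝟙 M) (P := projectiveResolution M)
    (Q := projectiveResolution M) (r • 𝟙 _) (by
      apply HomologicalComplex.to_single_hom_ext
      rw [HomologicalComplex.comp_f, HomologicalComplex.comp_f, ChainComplex.single₀_map_f_zero]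
      have h₀ : ∀ {A : ModuleCat.{u} R} (g : A ⟶ M), (r • 𝟙 A) ≫ g = g ≫ (r • 𝟙 M) := by simp
      exact h₀ (A := (resolution M).X 0) ((projectiveResolution M).π.f 0)), Functor.comp_map, h]
  have h' : ∀ {A B : ModuleCat.{u} R} (e : A ≅ B) (f : B ⟶ B), f = r • 𝟙 B →
      e.hom ≫ f ≫ e.inv = r • 𝟙 A := by
    rintro A B e _ rfl
    rw [Linear.smul_comp, Category.id_comp, Linear.comp_smul, Iso.hom_inv_id]
  exact h' _ _ (homologyFunctor_map_smul_id _ k r)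

/-- `Tor_k(R/I, N)` is annihilated by `I`. -/
lemma isTorsionBySet_tor (I : Ideal R) (k : ℕ) (N : ModuleCat.{u} R) :
    Module.IsTorsionBySet R (tor k (ModuleCat.of R (R ⧸ I)) N) I := by
  intro x r
  obtain ⟨r, hr⟩ := r
  have h0 : r • 𝟙 (ModuleCat.of R (R ⧸ I)) = (0 : R) • 𝟙 _ := by
    ext
    change Submodule.Quotient.mk (r * 1) = (Submodule.Quotient.mk (0 * 1) : R ⧸ I)
    rw [Submodule.Quotient.eq]
    simpa using hr
  have h1 := leftDerived_map_smul_id (ModuleCat.of R (R ⧸ I)) N k r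
  rw [h0, leftDerived_map_smul_id, zero_smul] at h1
  exact (congrArg (fun f => f.hom x) h1).symm

/-- The `R/I`-module structure of `Tor_k(R/I, N)`, the only one that is compatible with its
`R`-module structure. -/
instance torModule (I : Ideal R) (k : ℕ) (N : ModuleCat.{u} R) :
    Module (R ⧸ I) (tor k (ModuleCat.of R (R ⧸ I)) N) :=
  (isTorsionBySet_tor I k N).module

/-- The tensor product `K ⊗ K` of chain complexes, with the usual sign
`d (x ⊗ y) = d x ⊗ y + (-1) ^ i • x ⊗ d y` for `x` of degree `i`. -/
abbrev tensorSq (K : ChainComplex (ModuleCat.{u} R) ℕ) : ChainComplex (ModuleCat.{u} R) ℕ :=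
  HomologicalComplex.tensorObj K K

/-- The inclusion of the summand `K_i ⊗ K_j` into `(K ⊗ K)_n` if `i + j = n`, and zero otherwise. -/
abbrev ιSq (K : ChainComplex (ModuleCat.{u} R) ℕ) (i j n : ℕ) :
    K.X i ⊗ K.X j ⟶ (tensorSq K).X n :=
  HomologicalComplex.ιMapBifunctorOrZero K K (curriedTensor (ModuleCat.{u} R)) _ i j n

lemma ιSq_eq (K : ChainComplex (ModuleCat.{u} R) ℕ) (i j n : ℕ) (h : i + j = n) :
    ιSq K i j n = HomologicalComplex.ιTensorObj K K i j n h := dif_pos h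

lemma tensorSq_projective (K : ChainComplex (ModuleCat.{u} R) ℕ) [∀ i, Projective (K.X i)]
    (n : ℕ) : Projective ((tensorSq K).X n) := by
  have hP : ∀ i j, Projective (((curriedTensor (ModuleCat.{u} R)).obj (K.X i)).obj (K.X j)) := fun i j => by
    have : Module.Projective R (K.X i ⊗ K.X j : ModuleCat.{u} R) :=
      inferInstanceAs (Module.Projective R (K.X i ⊗[R] K.X j))
    exact ModuleCat.projective_of_categoryTheory_projective (K.X i ⊗ K.X j : ModuleCat.{u} R)
  refine ⟨fun {E X} g e he => ⟨HomologicalComplex.mapBifunctorDesc fun i j h =>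
    have := hP i j
    Projective.factorThru (P := ((curriedTensor (ModuleCat.{u} R)).obj (K.X i)).obj (K.X j))
      (HomologicalComplex.ιTensorObj K K i j n h ≫ g) e, ?_⟩⟩
  apply HomologicalComplex.mapBifunctor.hom_ext
  intro i j h
  rw [HomologicalComplex.ι_mapBifunctorDesc_assoc]
  have := hP i j
  exact Projective.factorThru_comp _ _

lemma ιSq_d (K : ChainComplex (ModuleCat.{u} R) ℕ) (i j n n' : ℕ) (h : i + j = n) :
    ιSq K i j n ≫ (tensorSq K).d n n' =
      (K.d i ((ComplexShape.down ℕ).next i) ▷ K.X j) ≫ ιSq K ((ComplexShape.down ℕ).next i) j n' +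
      ((-1 : ℤˣ) ^ i) • ((K.X i ◁ K.d j ((ComplexShape.down ℕ).next j)) ≫
        ιSq K i ((ComplexShape.down ℕ).next j) n') := by
  rw [ιSq_eq _ _ _ _ h,
    HomologicalComplex.mapBifunctor.d_eq, Preadditive.comp_add,
    HomologicalComplex.mapBifunctor.ι_D₁, HomologicalComplex.mapBifunctor.ι_D₂]
  congr 1
  · by_cases hi : (ComplexShape.down ℕ).Rel i ((ComplexShape.down ℕ).next i)
    · rw [HomologicalComplex.mapBifunctor.d₁_eq' _ _ _ _ hi]
      exact one_smul _ _
    · rw [HomologicalComplex.mapBifunctor.d₁_eq_zero _ _ _ _ _ _ _ hi, K.shape _ _ hi,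
        MonoidalPreadditive.zero_whiskerRight, zero_comp]

lemma exists_lift {M : ModuleCat.{u} R} (K : ChainComplex (ModuleCat.{u} R) ℕ)
    (hK : ∀ i, Projective (K.X i)) (P : ProjectiveResolution M) (φ : K.X 0 ⟶ M)
    (hφ : K.d 1 0 ≫ φ = 0) :
    ∃ f : K ⟶ P.complex, f.f 0 ≫ P.π.f 0 = φ := by
  let f0 : K.X 0 ⟶ P.complex.X 0 :=
    Projective.factorThru (show K.X 0 ⟶ ((ChainComplex.single₀ _).obj M).X 0 from φ) (P.π.f 0)
  have h0 : f0 ≫ P.π.f 0 = φ := Projective.factorThru_comp _ _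
  let f1 : K.X 1 ⟶ P.complex.X 1 := P.exact₀.liftFromProjective (K.d 1 0 ≫ f0) (by
    change (K.d 1 0 ≫ f0) ≫ P.π.f 0 = 0
    rw [Category.assoc, h0]; exact hφ)
  refine ⟨ChainComplex.mkHom _ _ f0 f1 (P.exact₀.liftFromProjective_comp _ _)
    fun n ⟨g, g', w⟩ => ⟨(P.exact_succ n).liftFromProjective
    (K.d (n + 2) (n + 1) ≫ g') (by simp [w]), (P.exact_succ n).liftFromProjective_comp _ _⟩, ?_⟩
  rw [ChainComplex.mkHom_f_0]
  exact h0

/-- The augmentation `P_0 ⟶ M` of the projective resolution `P` of `M`. -/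
abbrev augmentation (M : ModuleCat.{u} R) : (resolution M).X 0 ⟶ M :=
  (projectiveResolution M).π.f 0

/-- A product `M ⊗ M ⟶ M` lifts to a chain map `P ⊗ P ⟶ P`, where `P` is the projective resolution
of `M`. -/
lemma exists_mulLift (M : ModuleCat.{u} R) (μ : M ⊗ M ⟶ M) :
    ∃ f : tensorSq (resolution M) ⟶ resolution M,
      ιSq (resolution M) 0 0 0 ≫ f.f 0 ≫ augmentation M =
        (augmentation M ⊗ₘ augmentation M) ≫ μ := by
  have hd : (resolution M).d 1 0 ≫ augmentation M = 0 :=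
    (projectiveResolution M).complex_d_comp_π_f_zero
  let a : ∀ i, (resolution M).X i ⟶ M
    | 0 => augmentation M
    | _ + 1 => 0
  let φ : (tensorSq (resolution M)).X 0 ⟶ M :=
    HomologicalComplex.mapBifunctorDesc fun i j _ => (a i ⊗ₘ a j) ≫ μ
  have hφ0 : ιSq (resolution M) 0 0 0 ≫ φ = (augmentation M ⊗ₘ augmentation M) ≫ μ := by
    rw [ιSq_eq _ _ _ _ rfl]
    exact HomologicalComplex.ι_mapBifunctorDesc _ _ _ _
  have hφ : (tensorSq (resolution M)).d 1 0 ≫ φ = 0 := by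
    apply HomologicalComplex.mapBifunctor.hom_ext
    intro i j h
    have h' : i + j = 1 := h
    have key := ιSq_d (resolution M) i j 1 0 h
    rw [ιSq_eq _ _ _ _ h] at key
    rw [reassoc_of% key, comp_zero, Preadditive.add_comp, Linear.units_smul_comp, Category.assoc,
      Category.assoc]
    obtain ⟨rfl, rfl⟩ | ⟨rfl, rfl⟩ : (i = 1 ∧ j = 0) ∨ (i = 0 ∧ j = 1) := by omega
    · rw [ChainComplex.next_nat_succ, ChainComplex.next_nat_zero, hφ0,
        (resolution M).shape 0 0 (by simp), MonoidalPreadditive.whiskerLeft_zero, zero_comp,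
        smul_zero, add_zero, MonoidalCategory.whiskerRight_comp_tensorHom_assoc, hd,
        MonoidalPreadditive.zero_tensor, zero_comp]
    · rw [ChainComplex.next_nat_succ, ChainComplex.next_nat_zero, hφ0,
        (resolution M).shape 0 0 (by simp), MonoidalPreadditive.zero_whiskerRight, zero_comp,
        zero_add, MonoidalCategory.whiskerLeft_comp_tensorHom_assoc, hd,
        MonoidalPreadditive.tensor_zero, zero_comp, smul_zero]
  obtain ⟨f, hf⟩ := exists_lift (tensorSq (resolution M)) (tensorSq_projective _)
    (projectiveResolution M) φ hφ
  exact ⟨f, by rw [← hφ0, ← hf]; rfl⟩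

section

variable {Z Z' H H' X : Type*} [AddCommGroup Z] [AddCommGroup Z'] [AddCommGroup H] [AddCommGroup H']
  [AddCommGroup X] [Module R Z] [Module R Z'] [Module R H] [Module R H'] [Module R X]

/-- The map that `B` induces on the target of a surjection `p`. -/
def descend (p : Z →ₗ[R] H) (hp : Function.Surjective p) (B : Z →ₗ[R] X)
    (hB : ∀ z, p z = 0 → B z = 0) : H →ₗ[R] X :=
  (LinearMap.ker p).liftQ B hB ∘ₗ (p.quotKerEquivOfSurjective hp).symm.toLinearMap

lemma descend_apply (p : Z →ₗ[R] H) (hp : Function.Surjective p) (B : Z →ₗ[R] X)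
    (hB : ∀ z, p z = 0 → B z = 0) (z : Z) : descend p hp B hB (p z) = B z := by
  have : (p.quotKerEquivOfSurjective hp).symm (p z) = Submodule.Quotient.mk z := by
    rw [LinearEquiv.symm_apply_eq]; rfl
  rw [descend, LinearMap.comp_apply, LinearEquiv.coe_coe, this]
  exact Submodule.liftQ_apply _ _ _

/-- The bilinear map that `B` induces on the targets of surjections `p` and `q`. -/
def descend₂ (p : Z →ₗ[R] H) (hp : Function.Surjective p) (q : Z' →ₗ[R] H')
    (hq : Function.Surjective q) (B : Z →ₗ[R] Z' →ₗ[R] X)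
    (h₁ : ∀ z z', p z = 0 → B z z' = 0) (h₂ : ∀ z z', q z' = 0 → B z z' = 0) :
    H →ₗ[R] H' →ₗ[R] X :=
  (descend q hq (descend p hp B fun z hz => by ext z'; exact h₁ z z' hz).flip fun z' hz' => by
    ext x
    obtain ⟨z, rfl⟩ := hp x
    rw [LinearMap.flip_apply, descend_apply, h₂ z z' hz']; rfl).flip

lemma descend₂_apply (p : Z →ₗ[R] H) (hp : Function.Surjective p) (q : Z' →ₗ[R] H')
    (hq : Function.Surjective q) (B : Z →ₗ[R] Z' →ₗ[R] X)
    (h₁ : ∀ z z', p z = 0 → B z z' = 0) (h₂ : ∀ z z', q z' = 0 → B z z' = 0) (z : Z) (z' : Z') :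
    descend₂ p hp q hq B h₁ h₂ (p z) (q z') = B z z' := by
  rw [descend₂, LinearMap.flip_apply, descend_apply, LinearMap.flip_apply, descend_apply]

lemma map₂_leibniz {P₁ P₂ P₃ Q₁ Q₂ Q₃ N : Type*} [AddCommGroup P₁] [AddCommGroup P₂]
    [AddCommGroup P₃] [AddCommGroup Q₁] [AddCommGroup Q₂] [AddCommGroup Q₃] [AddCommGroup N]
    [Module R P₁] [Module R P₂] [Module R P₃] [Module R Q₁] [Module R Q₂] [Module R Q₃]
    [Module R N] (d₁ : P₁ →ₗ[R] Q₁) (d₂ : P₂ →ₗ[R] Q₂) (d₃ : P₃ →ₗ[R] Q₃)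
    (m : P₁ →ₗ[R] P₂ →ₗ[R] P₃) (m₁ : Q₁ →ₗ[R] P₂ →ₗ[R] Q₃) (m₂ : P₁ →ₗ[R] Q₂ →ₗ[R] Q₃)
    (e : ℤˣ) (h : ∀ x y, d₃ (m x y) = m₁ (d₁ x) y + e • m₂ x (d₂ y)) (ν : N →ₗ[R] N →ₗ[R] N)
    (x : P₁ ⊗[R] N) (y : P₂ ⊗[R] N) :
    d₃.rTensor N (TensorProduct.map₂ m ν x y) =
      TensorProduct.map₂ m₁ ν (d₁.rTensor N x) y +
        e • TensorProduct.map₂ m₂ ν x (d₂.rTensor N y) := by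
  induction x using TensorProduct.induction_on with
  | zero => simp
  | add x x' hx hx' =>
    simp only [map_add, LinearMap.add_apply, hx, hx', smul_add]
    abel
  | tmul p a =>
    induction y using TensorProduct.induction_on with
    | zero => simp
    | add y y' hy hy' =>
      simp only [map_add, hy, hy', smul_add]
      abel
    | tmul q b =>
      simp only [TensorProduct.map₂_apply_tmul, TensorProduct.map_tmul, LinearMap.rTensor_tmul, h,
        TensorProduct.add_tmul]
      rfl

end

/-- A bilinear product on `M` as a morphism `M ⊗ M ⟶ M`. -/
def mulHom {M : ModuleCat.{u} R} (μ : M →ₗ[R] M →ₗ[R] M) : M ⊗ M ⟶ M :=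
  ModuleCat.ofHom (TensorProduct.lift μ)

/-- A chain map `P ⊗ P ⟶ P` over the product `μ` of `M`. It is unique up to chain homotopy, so that
the products on homology below do not depend on the choice. -/
def mulLift (M : ModuleCat.{u} R) (μ : M →ₗ[R] M →ₗ[R] M) :
    tensorSq (resolution M) ⟶ resolution M :=
  (exists_mulLift M (mulHom μ)).choose

lemma mulLift_spec (M : ModuleCat.{u} R) (μ : M →ₗ[R] M →ₗ[R] M) :
    ιSq (resolution M) 0 0 0 ≫ (mulLift M μ).f 0 ≫ augmentation M =
      (augmentation M ⊗ₘ augmentation M) ≫ mulHom μ :=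
  (exists_mulLift M (mulHom μ)).choose_spec

/-- The components `P_i × P_j → P_n` of the chain map `P ⊗ P ⟶ P` (zero unless `i + j = n`). -/
def resMul (M : ModuleCat.{u} R) (μ : M →ₗ[R] M →ₗ[R] M) (i j n : ℕ) :
    (resolution M).X i →ₗ[R] (resolution M).X j →ₗ[R] (resolution M).X n :=
  TensorProduct.curry (ιSq (resolution M) i j n ≫ (mulLift M μ).f n).hom

lemma resMul_leibniz (M : ModuleCat.{u} R) (μ : M →ₗ[R] M →ₗ[R] M) (i j n n' : ℕ) (h : i + j = n)
    (x : (resolution M).X i) (y : (resolution M).X j) :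
    ((resolution M).d n n').hom (resMul M μ i j n x y) =
      resMul M μ _ j n' (((resolution M).d i ((ComplexShape.down ℕ).next i)).hom x) y +
      ((-1 : ℤˣ) ^ i) •
        resMul M μ i _ n' x (((resolution M).d j ((ComplexShape.down ℕ).next j)).hom y) := by
  have key := ιSq_d (resolution M) i j n n' h =≫ (mulLift M μ).f n'
  rw [Category.assoc, ← (mulLift M μ).comm, Preadditive.add_comp, Linear.units_smul_comp] at key
  exact congrArg (fun f => f.hom (x ⊗ₜ[R] y)) key

/-- The product `(p ⊗ a) * (q ⊗ b) = (p * q) ⊗ (a * b)` on `P ⊗ N`, where `a * b = ν a b`. -/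
def torComplexMul (M N : ModuleCat.{u} R) (μ : M →ₗ[R] M →ₗ[R] M) (ν : N →ₗ[R] N →ₗ[R] N)
    (i j n : ℕ) :
    (torComplex M N).X i →ₗ[R] (torComplex M N).X j →ₗ[R] (torComplex M N).X n :=
  TensorProduct.map₂ (resMul M μ i j n) ν

lemma torComplexMul_leibniz (M N : ModuleCat.{u} R) (μ : M →ₗ[R] M →ₗ[R] M)
    (ν : N →ₗ[R] N →ₗ[R] N) (i j n n' : ℕ) (h : i + j = n)
    (x : (torComplex M N).X i) (y : (torComplex M N).X j) :
    ((torComplex M N).d n n').hom (torComplexMul M N μ ν i j n x y) =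
      torComplexMul M N μ ν _ j n' (((torComplex M N).d i ((ComplexShape.down ℕ).next i)).hom x) y +
      ((-1 : ℤˣ) ^ i) •
        torComplexMul M N μ ν i _ n' x
          (((torComplex M N).d j ((ComplexShape.down ℕ).next j)).hom y) :=
  map₂_leibniz (((resolution M).d i _).hom) (((resolution M).d j _).hom)
    (((resolution M).d n n').hom) _ _ _ _ (resMul_leibniz M μ i j n n' h) ν x y

lemma d_iCycles (K : ChainComplex (ModuleCat.{u} R) ℕ) (i j : ℕ) (z : K.cycles i) :
    (K.d i j).hom ((K.iCycles i).hom z) = 0 :=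
  congrArg (fun f => f.hom z) (K.iCycles_d i j)

/-- The product of cycles of `P ⊗ N`. -/
def cyclesMul (M N : ModuleCat.{u} R) (μ : M →ₗ[R] M →ₗ[R] M) (ν : N →ₗ[R] N →ₗ[R] N)
    (i j n : ℕ) (h : i + j = n) :
    (torComplex M N).cycles i →ₗ[R] (torComplex M N).cycles j →ₗ[R] (torComplex M N).cycles n :=
  TensorProduct.curry ((torComplex M N).liftCycles
    (A := ModuleCat.of R ((torComplex M N).cycles i ⊗[R] (torComplex M N).cycles j))
    (ModuleCat.ofHom (TensorProduct.lift ((torComplexMul M N μ ν i j n).compl₁₂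
      ((torComplex M N).iCycles i).hom ((torComplex M N).iCycles j).hom))) _ rfl (by
        apply ModuleCat.hom_ext
        apply TensorProduct.ext'
        intro x y
        refine (torComplexMul_leibniz M N μ ν i j n _ h _ _).trans ?_
        rw [d_iCycles, d_iCycles, map_zero, map_zero, LinearMap.zero_apply, smul_zero, add_zero]
        rfl)).hom

lemma iCycles_cyclesMul (M N : ModuleCat.{u} R) (μ : M →ₗ[R] M →ₗ[R] M) (ν : N →ₗ[R] N →ₗ[R] N)
    (i j n : ℕ) (h : i + j = n) (x : (torComplex M N).cycles i) (y : (torComplex M N).cycles j) :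
    ((torComplex M N).iCycles n).hom (cyclesMul M N μ ν i j n h x y) =
      torComplexMul M N μ ν i j n (((torComplex M N).iCycles i).hom x)
        (((torComplex M N).iCycles j).hom y) :=
  congrArg (fun f : ModuleCat.of R ((torComplex M N).cycles i ⊗[R] (torComplex M N).cycles j) ⟶ _ =>
    f.hom (x ⊗ₜ[R] y)) ((torComplex M N).liftCycles_i _ _ _ _)

lemma homologyπ_surjective (K : ChainComplex (ModuleCat.{u} R) ℕ) (i : ℕ) :
    Function.Surjective (K.homologyπ i).hom :=
  (ModuleCat.epi_iff_surjective _).1 inferInstance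

lemma homologyπ_eq_zero_iff (K : ChainComplex (ModuleCat.{u} R) ℕ) (i : ℕ) (z : K.cycles i) :
    (K.homologyπ i).hom z = 0 ↔ ∃ w, (K.d (i + 1) i).hom w = (K.iCycles i).hom z := by
  have hex := (ShortComplex.moduleCat_exact_iff _).1
    (ShortComplex.exact_of_g_is_cokernel (ShortComplex.mk _ _ (K.toCycles_comp_homologyπ (i + 1) i))
      (K.homologyIsCokernel (i + 1) i (by simp)))
  have hi : ∀ w, (K.iCycles i).hom ((K.toCycles (i + 1) i).hom w) = (K.d (i + 1) i).hom w :=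
    fun w => congrArg (fun f => f.hom w) (K.toCycles_i (i + 1) i)
  constructor
  · intro hz
    obtain ⟨w, hw⟩ := hex z hz
    exact ⟨w, by rw [← hi]; exact congrArg _ hw⟩
  · rintro ⟨w, hw⟩
    have : (K.toCycles (i + 1) i).hom w = z := by
      apply (ModuleCat.mono_iff_injective (K.iCycles i)).1 inferInstance
      exact (hi w).trans hw
    rw [← this]
    exact congrArg (fun f => f.hom w) (K.toCycles_comp_homologyπ (i + 1) i)

/-- The product on the homology of `P ⊗ N`. -/
def homologyMul (M N : ModuleCat.{u} R) (μ : M →ₗ[R] M →ₗ[R] M) (ν : N →ₗ[R] N →ₗ[R] N)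
    (i j : ℕ) :
    (torComplex M N).homology i →ₗ[R] (torComplex M N).homology j →ₗ[R]
      (torComplex M N).homology (i + j) :=
  descend₂ _ (homologyπ_surjective _ i) _ (homologyπ_surjective _ j)
    ((cyclesMul M N μ ν i j (i + j) rfl).compr₂ ((torComplex M N).homologyπ (i + j)).hom)
    (fun x y hx => by
      obtain ⟨w, hw⟩ := (homologyπ_eq_zero_iff _ _ _).1 hx
      refine (homologyπ_eq_zero_iff _ _ _).2
        ⟨torComplexMul M N μ ν (i + 1) j (i + j + 1) w (((torComplex M N).iCycles j).hom y), ?_⟩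
      rw [torComplexMul_leibniz _ _ _ _ _ _ _ _ (by omega), d_iCycles, map_zero, smul_zero,
        add_zero, iCycles_cyclesMul, ChainComplex.next_nat_succ, hw])
    (fun x y hy => by
      obtain ⟨w, hw⟩ := (homologyπ_eq_zero_iff _ _ _).1 hy
      refine (homologyπ_eq_zero_iff _ _ _).2
        ⟨((-1 : ℤˣ) ^ i) • torComplexMul M N μ ν i (j + 1) (i + j + 1)
          (((torComplex M N).iCycles i).hom x) w, ?_⟩
      have hs : ∀ {A B : ModuleCat.{u} R} (f : A →ₗ[R] B) (e : ℤˣ) (a : A),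
          f (e • a) = e • f a := fun f e a => map_zsmul f (e : ℤ) a
      rw [hs, torComplexMul_leibniz _ _ _ _ _ _ _ _ (by omega), d_iCycles, map_zero,
        LinearMap.zero_apply, zero_add, iCycles_cyclesMul, ChainComplex.next_nat_succ, hw,
        smul_smul, Int.units_mul_self, one_smul])

lemma homologyMul_homologyπ (M N : ModuleCat.{u} R) (μ : M →ₗ[R] M →ₗ[R] M)
    (ν : N →ₗ[R] N →ₗ[R] N) (i j : ℕ) (x : (torComplex M N).cycles i)
    (y : (torComplex M N).cycles j) :
    homologyMul M N μ ν i j (((torComplex M N).homologyπ i).hom x)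
        (((torComplex M N).homologyπ j).hom y) =
      ((torComplex M N).homologyπ (i + j)).hom (cyclesMul M N μ ν i j (i + j) rfl x y) :=
  descend₂_apply _ _ _ _ _ _ _ _ _

/-- The (internal) product `Tor_i(M, N) × Tor_j(M, N) → Tor_{i+j}(M, N)` induced by products `μ` on `M`
and `ν` on `N`. -/
def torMul (M N : ModuleCat.{u} R) (μ : M →ₗ[R] M →ₗ[R] M) (ν : N →ₗ[R] N →ₗ[R] N)
    (i j : ℕ) : tor i M N →ₗ[R] tor j M N →ₗ[R] tor (i + j) M N :=
  ((homologyMul M N μ ν i j).compl₁₂ (torIso i M N).hom.hom (torIso j M N).hom.hom).compr₂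
    (torIso (i + j) M N).inv.hom

/-- The ideal power `I ^ s`, as an `R`-module. -/
abbrev powMod (I : Ideal R) (s : ℕ) : ModuleCat.{u} R := ModuleCat.of R ↥(I ^ s)

/-- The quotient `I ^ a / I ^ b` (used for `a ≤ b`). -/
abbrev powQuot (I : Ideal R) (a b : ℕ) : ModuleCat.{u} R :=
  ModuleCat.of R (↥(I ^ a) ⧸ Submodule.comap (Submodule.subtype (I ^ a)) (I ^ b))

/-- The projection `I ^ s ⟶ I ^ s / I ^ (s + 1)`. -/
def powProj (I : Ideal R) (s : ℕ) : powMod I s ⟶ powQuot I s (s + 1) :=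
  ModuleCat.ofHom (Submodule.mkQ _)

/-- The multiplication of the (non-unital) algebra `I ^ s`. -/
def powMul (I : Ideal R) (s : ℕ) : powMod I s →ₗ[R] powMod I s →ₗ[R] powMod I s :=
  (LinearMap.lsmul R ↥(I ^ s)).comp (I ^ s).subtype

lemma coe_powMul (I : Ideal R) (s : ℕ) (x y : ↥(I ^ s)) :
    ((powMul I s x y : ↥(I ^ s)) : R) = (x : R) * (y : R) := rfl

/-- The sequence `I ^ (s + 1) / I ^ (s + 2) ⟶ I ^ s / I ^ (s + 2) ⟶ I ^ s / I ^ (s + 1)`. -/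
def powSeq (I : Ideal R) (s : ℕ) : ShortComplex (ModuleCat.{u} R) :=
  ShortComplex.mk (X₁ := powQuot I (s + 1) (s + 2)) (X₂ := powQuot I s (s + 2))
    (X₃ := powQuot I s (s + 1))
    (ModuleCat.ofHom (Submodule.mapQ _ _
      (Submodule.inclusion (Ideal.pow_le_pow_right (Nat.le_succ s))) fun _ hx => hx))
    (ModuleCat.ofHom (Submodule.mapQ _ _ LinearMap.id
      fun _ hx => Ideal.pow_le_pow_right (Nat.le_succ (s + 1)) hx))
    (by
      apply ModuleCat.hom_ext
      apply Submodule.linearMap_qext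
      ext x
      exact (Submodule.Quotient.mk_eq_zero _).2 x.2)

lemma powSeq_shortExact (I : Ideal R) (s : ℕ) : (powSeq I s).ShortExact := by
  refine
    { exact := (ShortComplex.moduleCat_exact_iff _).2 ?_
      mono_f := (ModuleCat.mono_iff_injective _).2 ?_
      epi_g := (ModuleCat.epi_iff_surjective _).2 ?_ }
  · intro y hy
    obtain ⟨y, rfl⟩ := Submodule.Quotient.mk_surjective _ y
    have hy' : (y : R) ∈ I ^ (s + 1) := (Submodule.Quotient.mk_eq_zero
      (Submodule.comap (Submodule.subtype (I ^ s)) (I ^ (s + 1))) (x := y)).1 hy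
    exact ⟨Submodule.Quotient.mk ⟨(y : R), hy'⟩, rfl⟩
  · refine (injective_iff_map_eq_zero (powSeq I s).f.hom).2 fun x hx => ?_
    obtain ⟨x, rfl⟩ := Submodule.Quotient.mk_surjective _ x
    have hx' : (x : R) ∈ I ^ (s + 2) := (Submodule.Quotient.mk_eq_zero
      (Submodule.comap (Submodule.subtype (I ^ s)) (I ^ (s + 2)))
      (x := Submodule.inclusion (Ideal.pow_le_pow_right (Nat.le_succ s)) x)).1 hx
    exact (Submodule.Quotient.mk_eq_zero _).2 hx'
  · intro z
    obtain ⟨z, rfl⟩ := Submodule.Quotient.mk_surjective _ z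
    exact ⟨Submodule.Quotient.mk z, rfl⟩

/-- The map `p_* : Tor_k(R/I, I ^ s) ⟶ Tor_k(R/I, I ^ s / I ^ (s + 1))`. -/
def torPowProj (I : Ideal R) (s k : ℕ) :
    tor k (ModuleCat.of R (R ⧸ I)) (powMod I s) ⟶
      tor k (ModuleCat.of R (R ⧸ I)) (powQuot I s (s + 1)) :=
  torMap k (ModuleCat.of R (R ⧸ I)) (powProj I s)

/-- The connecting homomorphism
`∂ : Tor_{k+1}(R/I, I ^ s / I ^ (s + 1)) ⟶ Tor_k(R/I, I ^ (s + 1) / I ^ (s + 2))`. -/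
def torPowδ (I : Ideal R) (s k : ℕ) :
    tor (k + 1) (ModuleCat.of R (R ⧸ I)) (powQuot I s (s + 1)) ⟶
      tor k (ModuleCat.of R (R ⧸ I)) (powQuot I (s + 1) (s + 2)) :=
  torδ k (ModuleCat.of R (R ⧸ I)) (powSeq_shortExact I s)

/-- The product `Tor_i(R/I, I ^ s) × Tor_j(R/I, I ^ s) → Tor_{i+j}(R/I, I ^ s)` induced by the
multiplications of `R/I` and of `I ^ s`. -/
def torPowMul (I : Ideal R) (s i j : ℕ) :
    tor i (ModuleCat.of R (R ⧸ I)) (powMod I s) →ₗ[R]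
      tor j (ModuleCat.of R (R ⧸ I)) (powMod I s) →ₗ[R]
        tor (i + j) (ModuleCat.of R (R ⧸ I)) (powMod I s) :=
  torMul (ModuleCat.of R (R ⧸ I)) (powMod I s) (LinearMap.mul R (R ⧸ I)) (powMul I s) i j

end IdealTor

end

noncomputable section

open CategoryTheory CategoryTheory.Limits CategoryTheory.MonoidalCategory
open scoped TensorProduct

/-! All three parts rest on one fact: for every `s` the inclusion of `I ^ (s + 1)` in `I ^ s`
induces the zero map on Tor over `R / I`.

Given this, the long exact sequence of `I ^ (s + 1) → I ^ s → I ^ s / I ^ (s + 1)` makes `p_*`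
injective, with image the kernel of its connecting map `δ`. By naturality `∂` is `δ` followed by the
map `p_*` for `s + 1`, which is injective, so `∂` and `δ` have the same kernel. For `1 ≤ s` the
product of two elements of `I ^ s` lies in `I ^ (s + 1)`, so the product on Tor factors through the
zero map.

The Koszul complex of the sequence resolves `R / I`, so the vanishing says that a Koszul cycle with
coefficients in `I ^ (s + 1)` bounds a chain with coefficients in `I ^ s` (`PowExactAt`). This is
proved by induction on `s` together with quasi-regularity (`QuasiRegularAt`): each of the two feeds
the next case of the other (`powExactAt`). The model is the Koszul complex of the variables of a
polynomial ring, which is exact in positive polynomial degree (`exists_d_X_eq`) over any coefficient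
ring; chains are lifted to homogeneous polynomials, corrected there by boundaries, and evaluated at
the sequence.

For freeness, quasi-regularity gives each element of `I ^ s` a leading form, homogeneous of degree
`s` over `R / I`. On Koszul cycles with coefficients in `I ^ s` the leading form has exactly the
boundaries as kernel, and its image is all homogeneous cycles of the polynomial model
(`homologyEquiv`). These form a free module by induction on the number of variables
(`homogCycles_free`). -/

namespace Koszul

/-! ### Index sets for the exterior powers, built by deciding on the last element. -/

/-- The subsets of `{0, …, m - 1}` with `k` elements. -/
inductive Idx : ℕ → ℕ → Type
  | nil : Idx 0 0
  | skip {m k : ℕ} : Idx m k → Idx (m + 1) k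
  | take {m k : ℕ} : Idx m k → Idx (m + 1) (k + 1)

namespace Idx

instance : ∀ m k : ℕ, Finite (Idx m k)
  | 0, 0 => Finite.of_surjective (fun _ : Unit => nil) fun | nil => ⟨(), rfl⟩
  | 0, _ + 1 => @Finite.of_subsingleton _ ⟨fun a => nomatch a⟩
  | m + 1, 0 =>
    have := instFinite m 0
    Finite.of_surjective (skip (m := m)) fun | skip i => ⟨i, rfl⟩
  | m + 1, k + 1 =>
    have := instFinite m k
    have := instFinite m (k + 1)
    Finite.of_surjective (Sum.elim (skip (m := m)) take) fun
      | skip i => ⟨.inl i, rfl⟩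
      | take i => ⟨.inr i, rfl⟩

instance (m k : ℕ) : Fintype (Idx m k) := Fintype.ofFinite _

instance (m k : ℕ) : DecidableEq (Idx m k) := Classical.decEq _

/-- The empty subset of `{0, …, m - 1}`. -/
def empty : ∀ m : ℕ, Idx m 0
  | 0 => nil
  | m + 1 => skip (empty m)

instance (m : ℕ) : Unique (Idx m 0) where
  default := empty m
  uniq := by
    induction m with
    | zero => exact fun | nil => rfl
    | succ m ih => exact fun | skip i => congrArg skip (ih i)

end Idx

section Join

variable {M : Type*} {m k : ℕ}

/-- A family indexed by the `(k + 1)`-subsets of `{0, …, m}`, given on the subsets that do not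
contain `m` and on those that do. -/
def join (a : Idx m (k + 1) → M) (b : Idx m k → M) : Idx (m + 1) (k + 1) → M
  | .skip i => a i
  | .take i => b i

@[simp] lemma join_skip (a : Idx m (k + 1) → M) (b : Idx m k → M) (i : Idx m (k + 1)) :
    join a b (.skip i) = a i := rfl

@[simp] lemma join_take (a : Idx m (k + 1) → M) (b : Idx m k → M) (i : Idx m k) :
    join a b (.take i) = b i := rfl

end Join

/-! ### The Koszul differential, as an iterated mapping cone. -/

section Differential

variable {R M : Type*} [CommRing R] [AddCommGroup M] [Module R M]

/-- The coordinates of the Koszul differential. -/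
def dCoord (M : Type*) [AddCommGroup M] [Module R M] (x : ℕ → R) :
    ∀ {m k : ℕ}, Idx m k → (Idx m (k + 1) → M) →ₗ[R] M
  | _, _, .nil => 0
  | m + 1, _, .skip i =>
    dCoord M x i ∘ₗ LinearMap.funLeft R M .skip + x m • LinearMap.proj (.take i)
  | _, _, .take i => -(dCoord M x i ∘ₗ LinearMap.funLeft R M .take)

/-- The differential of the Koszul complex of `x 0, …, x (m - 1)` with coefficients in `M`. -/
def d (x : ℕ → R) {m k : ℕ} : (Idx m (k + 1) → M) →ₗ[R] Idx m k → M :=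
  LinearMap.pi (dCoord M x)

variable (x : ℕ → R) {m k : ℕ}

@[simp] lemma d_nil (z : Idx 0 1 → M) : d x z .nil = 0 := rfl

@[simp] lemma d_skip (z : Idx (m + 1) (k + 1) → M) (i : Idx m k) :
    d x z (.skip i) = d x (fun j => z (.skip j)) i + x m • z (.take i) := rfl

@[simp] lemma d_take (z : Idx (m + 1) (k + 2) → M) (i : Idx m k) :
    d x z (.take i) = -d x (fun j => z (.take j)) i := rfl

lemma d_zero_left {k : ℕ} (z : Idx 0 (k + 1) → M) : d x z = 0 := by
  ext i
  cases i; rfl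

lemma d_d (z : Idx m (k + 2) → M) : d x (d x z) = 0 := by
  induction m generalizing k with
  | zero => exact d_zero_left x _
  | succ m ih =>
    ext i
    cases i with
    | skip i =>
      have h : (fun j => d x z (.skip j)) =
          d x (fun j => z (.skip j)) + x m • (fun j => z (.take j) : Idx m (k + 1) → M) := rfl
      rw [d_skip, h, map_add, ih, map_smul, d_take]
      simp
    | take i =>
      have h : (fun j => d x z (.take j)) = -d x (fun j => z (.take j)) := rfl
      rw [d_take, h, map_neg, ih]
      simp

/-- Naturality in ring and coefficients at once, so that it covers evaluation of polynomials,
reduction modulo `I`, the inclusion of an ideal in `R`, and `r ↦ r • a`. -/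
lemma d_map {R' M' : Type*} [CommRing R'] [AddCommGroup M'] [Module R' M'] (x' : ℕ → R')
    (φ : M →+ M') (hφ : ∀ i < m, ∀ a, φ (x i • a) = x' i • φ a) (z : Idx m (k + 1) → M)
    (i : Idx m k) : φ (d x z i) = d x' (fun j => φ (z j)) i := by
  induction m generalizing k with
  | zero => cases i; simp
  | succ m ih =>
    have ih := fun k => @ih k fun i hi => hφ i (by omega)
    cases i with
    | skip i => simp [ih, hφ m]
    | take i => rw [d_take, d_take, map_neg, ih]

lemma d_mem {N N' : AddSubgroup M} (h : ∀ i < m, ∀ a ∈ N, x i • a ∈ N') (z : Idx m (k + 1) → M)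
    (hz : ∀ i, z i ∈ N) (i : Idx m k) : d x z i ∈ N' := by
  induction m generalizing k with
  | zero => cases i; exact N'.zero_mem
  | succ m ih =>
    have ih := fun k => @ih k fun i hi => h i (by omega)
    cases i with
    | skip i => exact N'.add_mem (ih _ _ (fun _ => hz _) i) (h m (by omega) _ (hz _))
    | take i => exact N'.neg_mem (ih _ _ (fun _ => hz _) i)

/-- The extension by zero to the subsets that contain `m`. -/
def extend : ∀ {k : ℕ}, (Idx m k → M) →ₗ[R] Idx (m + 1) k → M
  | 0 => LinearMap.pi fun | .skip i => LinearMap.proj i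
  | _ + 1 => LinearMap.pi fun
    | .skip i => LinearMap.proj i
    | .take _ => 0

@[simp] lemma extend_skip (a : Idx m k → M) (i : Idx m k) :
    extend (R := R) a (.skip i) = a i := by cases k <;> rfl

@[simp] lemma extend_take (a : Idx m (k + 1) → M) (i : Idx m k) :
    extend (R := R) a (.take i) = 0 := rfl

/-- The extension by zero to the subsets that do not contain `m`. -/
def joinZero : (Idx m k → M) →ₗ[R] Idx (m + 1) (k + 1) → M where
  toFun b := join 0 b
  map_add' _ _ := funext fun
    | .skip _ => (add_zero _).symm
    | .take _ => rfl
  map_smul' r _ := funext fun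
    | .skip _ => (smul_zero r).symm
    | .take _ => rfl

lemma d_extend {R' : Type*} [CommRing R'] [Module R' M] (a : Idx m (k + 1) → M) :
    d x (extend (R := R') a) = extend (R := R') (d x a) := by
  ext i
  cases i with
  | skip i => simp
  | take i =>
    have h : (fun j => extend (R := R') a (.take j)) = 0 := rfl
    rw [d_take, h]
    simp

/-- The cycles of the Koszul complex, that is, everything in degree zero. -/
def IsCycle (x : ℕ → R) {m : ℕ} : ∀ {k : ℕ}, (Idx m k → M) → Prop
  | 0, _ => True
  | _ + 1, z => d x z = 0

lemma isCycle_d (z : Idx m (k + 1) → M) : IsCycle x (d x z) := by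
  cases k with
  | zero => trivial
  | succ k => exact d_d x z

lemma IsCycle.add {x : ℕ → R} {z w : Idx m k → M} (hz : IsCycle x z) (hw : IsCycle x w) :
    IsCycle x (z + w) := by
  cases k with
  | zero => trivial
  | succ k =>
    change d x (z + w) = 0
    rw [map_add, show d x z = 0 from hz, show d x w = 0 from hw, add_zero]

lemma isCycle_zero : IsCycle x (0 : Idx m k → M) := by
  cases k with
  | zero => trivial
  | succ k => exact map_zero (d x)

lemma IsCycle.extend {R' : Type*} [CommRing R'] [Module R' M] {x : ℕ → R} {z : Idx m k → M}
    (hz : IsCycle x z) : IsCycle x (extend (R := R') z) := by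
  cases k with
  | zero => trivial
  | succ k =>
    change d x (Koszul.extend (R := R') z) = 0
    rw [d_extend, show d x z = 0 from hz, map_zero]

end Differential

/-! ### Exactness for a weakly regular sequence. -/

section Exact

variable {R : Type*} [CommRing R] (x : ℕ → R)

lemma mem_span_iff_exists_d {m : ℕ} {b : R} :
    b ∈ Ideal.span (x '' Set.Iio m) ↔ ∃ w : Idx m 1 → R, d x w default = b := by
  have hS : ∀ m, x '' Set.Iio (m + 1) = insert (x m) (x '' Set.Iio m) := fun m => by
    rw [← Set.image_insert_eq]
    congr 1
    ext i
    simp only [Set.mem_Iio, Set.mem_insert_iff]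
    omega
  induction m generalizing b with
  | zero =>
    rw [show Set.Iio 0 = (∅ : Set ℕ) by simp, Set.image_empty, Ideal.span_empty, Ideal.mem_bot]
    exact ⟨fun h => ⟨0, h.symm⟩, fun ⟨_, h⟩ => h.symm⟩
  | succ m ih =>
    rw [hS, Ideal.mem_span_insert]
    constructor
    · rintro ⟨a, c, hc, rfl⟩
      obtain ⟨w, rfl⟩ := ih.1 hc
      refine ⟨join w fun _ => a, ?_⟩
      change d x w default + x m * a = _
      ring
    · rintro ⟨w, rfl⟩
      refine ⟨w (.take default), _, ih.2 ⟨fun j => w (.skip j), rfl⟩, ?_⟩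
      change d x (fun j => w (.skip j)) default + x m * w (.take default) = _
      ring

/-- The sequence `x 0, …, x (m - 1)` is weakly regular. -/
def IsWeaklyRegular (m : ℕ) : Prop :=
  ∀ i < m, ∀ b, x i * b ∈ Ideal.span (x '' Set.Iio i) → b ∈ Ideal.span (x '' Set.Iio i)

variable {x}

/-- The Koszul complex of a weakly regular sequence is exact in positive degrees. -/
theorem exists_d_eq {m k : ℕ} (hx : IsWeaklyRegular x m) (z : Idx m (k + 1) → R)
    (hz : d x z = 0) : ∃ w, d x w = z := by
  induction m generalizing k with
  | zero => exact ⟨0, funext fun i => nomatch i⟩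
  | succ m ih =>
    have ih := fun k => @ih k fun i hi => hx i (by omega)
    have hskip : d x (fun j => z (.skip j)) + x m • (fun j => z (.take j)) = 0 :=
      funext fun i => congrFun hz (.skip i)
    -- The components containing `m` form a boundary: in the lowest degree by regularity of `x m`
    -- modulo the earlier elements, and above it by induction, since they form a cycle.
    obtain ⟨c, hc⟩ : ∃ c, d x c = fun j => z (.take j) := by
      cases k with
      | zero =>
        have h : x m * z (.take default) ∈ Ideal.span (x '' Set.Iio m) :=
          (mem_span_iff_exists_d x).2 ⟨-fun j => z (.skip j), by
            rw [map_neg]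
            exact neg_eq_of_add_eq_zero_right (congrFun hskip default)⟩
        obtain ⟨c, hc⟩ := (mem_span_iff_exists_d x).1 (hx m (by omega) _ h)
        exact ⟨c, funext fun i => by rw [Unique.eq_default i, hc]⟩
      | succ k =>
        exact ih _ _ (funext fun i => neg_eq_zero.1 (congrFun hz (.take i)))
    -- With `c` at hand, the remaining components become a cycle after adding `x m • c`. The sign in
    -- `join f (-c)` matches the sign of `d` on the components containing `m`.
    obtain ⟨f, hf⟩ := ih _ ((fun j => z (.skip j)) + x m • c) (by
      rw [map_add, map_smul, hc, hskip])
    refine ⟨join f (-c), funext fun i => ?_⟩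
    cases i with
    | skip i =>
      change d x f i + x m * -c i = _
      rw [hf]
      simp
    | take i =>
      change -d x (-c) i = _
      rw [map_neg, hc]
      simp

end Exact

/-! ### The Koszul complex of the variables and its homogeneous cycles. -/

section Polynomial

variable (A : Type*) [CommRing A]

/-- The homogeneous polynomials of degree `s` in the variables `X 0, …, X (m - 1)`. -/
def homogPoly (m s : ℕ) : Submodule A (MvPolynomial ℕ A) :=
  MvPolynomial.restrictSupport A {α | α.degree = s ∧ ∀ i, m ≤ i → α i = 0}

instance (m s : ℕ) : Module.Free A (homogPoly A m s) :=
  Module.Free.of_basis (MvPolynomial.basisRestrictSupport A _)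

variable {A}

lemma mem_homogPoly {m s : ℕ} {f : MvPolynomial ℕ A} :
    f ∈ homogPoly A m s ↔ ∀ α, f.coeff α ≠ 0 → α.degree = s ∧ ∀ i, m ≤ i → α i = 0 := by
  rw [homogPoly, MvPolynomial.mem_restrictSupport_iff]
  simp only [Set.subset_def, Finset.mem_coe, MvPolynomial.mem_support_iff]
  rfl

lemma homogPoly_mono {m m' : ℕ} (h : m ≤ m') (s : ℕ) : homogPoly A m s ≤ homogPoly A m' s :=
  fun _ hf => mem_homogPoly.2 fun α hα =>
    ⟨(mem_homogPoly.1 hf α hα).1, fun i hi => (mem_homogPoly.1 hf α hα).2 i (h.trans hi)⟩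

lemma X_mul_mem_homogPoly {m s i : ℕ} (hi : i < m) {f : MvPolynomial ℕ A}
    (hf : f ∈ homogPoly A m s) : MvPolynomial.X i * f ∈ homogPoly A m (s + 1) := by
  refine mem_homogPoly.2 fun α hα => ?_
  rw [MvPolynomial.coeff_X_mul'] at hα
  split_ifs at hα with h
  · obtain ⟨h1, h2⟩ := mem_homogPoly.1 hf _ hα
    have h3 : α = (α - Finsupp.single i 1) + Finsupp.single i 1 := by
      rw [tsub_add_cancel_of_le]
      simpa [Nat.one_le_iff_ne_zero] using h
    rw [h3]
    refine ⟨by simp [h1], fun j hj => ?_⟩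
    rw [Finsupp.add_apply, h2 j hj, Finsupp.single_apply, if_neg (by omega), add_zero]
  · exact absurd rfl hα

lemma C_mem_homogPoly (m : ℕ) (a : A) : MvPolynomial.C a ∈ homogPoly A m 0 := by
  refine mem_homogPoly.2 fun α hα => ?_
  rw [MvPolynomial.coeff_C] at hα
  split_ifs at hα with h
  · subst h; simp
  · exact absurd rfl hα

lemma eq_C_of_mem_homogPoly {m : ℕ} {f : MvPolynomial ℕ A} (hf : f ∈ homogPoly A m 0) :
    f = MvPolynomial.C (f.coeff 0) := by
  ext α
  rw [MvPolynomial.coeff_C]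
  split_ifs with h
  · rw [h]
  · by_contra h'
    exact h ((Finsupp.degree_eq_zero_iff _).1 (mem_homogPoly.1 hf α h').1).symm

lemma homogPoly_zero_succ (s : ℕ) {f : MvPolynomial ℕ A} (hf : f ∈ homogPoly A 0 (s + 1)) :
    f = 0 := by
  ext α
  by_contra h
  obtain ⟨h1, h2⟩ := mem_homogPoly.1 hf α h
  have : α = 0 := Finsupp.ext fun i => h2 i (Nat.zero_le i)
  simp [this] at h1

lemma exists_eq_add_X_mul {m s : ℕ} {f : MvPolynomial ℕ A}
    (hf : f ∈ homogPoly A (m + 1) (s + 1)) :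
    ∃ g ∈ homogPoly A m (s + 1), ∃ h ∈ homogPoly A (m + 1) s, f = g + MvPolynomial.X m * h := by
  refine ⟨f.modMonomial (Finsupp.single m 1), mem_homogPoly.2 fun α hα => ?_,
    f.divMonomial (Finsupp.single m 1), mem_homogPoly.2 fun α hα => ?_, ?_⟩
  · by_cases h : Finsupp.single m 1 ≤ α
    · exact absurd (MvPolynomial.coeff_modMonomial_of_le _ h) hα
    · rw [MvPolynomial.coeff_modMonomial_of_not_le _ h] at hα
      obtain ⟨h1, h2⟩ := mem_homogPoly.1 hf α hα
      refine ⟨h1, fun i hi => ?_⟩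
      obtain rfl | hi := hi.eq_or_lt
      · simpa [Nat.one_le_iff_ne_zero] using h
      · exact h2 i hi
  · rw [MvPolynomial.coeff_divMonomial] at hα
    obtain ⟨h1, h2⟩ := mem_homogPoly.1 hf _ hα
    refine ⟨by rw [map_add, Finsupp.degree_single] at h1; omega, fun i hi => ?_⟩
    have := h2 i hi
    simp only [Finsupp.add_apply] at this
    omega
  · rw [add_comm]
    exact (MvPolynomial.divMonomial_add_modMonomial_single f m).symm

/-- The variable `X m` does not occur in `homogPoly A m s`, whereas it occurs in every monomial of a
multiple of `X m`. This drives all the uniqueness arguments below. -/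
lemma eq_zero_of_X_mul_mem {m s : ℕ} {f : MvPolynomial ℕ A}
    (hf : MvPolynomial.X m * f ∈ homogPoly A m s) : f = 0 := by
  ext α
  by_contra h
  have := (mem_homogPoly.1 hf (Finsupp.single m 1 + α) (by
    rwa [MvPolynomial.coeff_X_mul])).2 m le_rfl
  simp at this

/-- The Koszul differential of the sequence of the variables. -/
abbrev dX {m k : ℕ} : (Idx m (k + 1) → MvPolynomial ℕ A) →ₗ[MvPolynomial ℕ A]
    (Idx m k → MvPolynomial ℕ A) :=
  d MvPolynomial.X

variable (A) in
/-- The cycles of the Koszul complex of `X 0, …, X (m - 1)` with homogeneous coefficients. -/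
def homogCycles (m k s : ℕ) : Submodule A (Idx m k → MvPolynomial ℕ A) where
  carrier := {z | (∀ i, z i ∈ homogPoly A m s) ∧ IsCycle (R := MvPolynomial ℕ A) MvPolynomial.X z}
  add_mem' hz hw := ⟨fun i => add_mem (hz.1 i) (hw.1 i), hz.2.add hw.2⟩
  zero_mem' := ⟨fun _ => zero_mem _, isCycle_zero _⟩
  smul_mem' a z hz := by
    refine ⟨fun i => Submodule.smul_mem _ a (hz.1 i), ?_⟩
    cases k with
    | zero => trivial
    | succ k =>
      change dX (a • z) = 0
      rw [LinearMap.map_smul_of_tower, show dX z = 0 from hz.2, smul_zero]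

lemma mem_homogCycles {m k s : ℕ} {z : Idx m k → MvPolynomial ℕ A} :
    z ∈ homogCycles A m k s ↔
      (∀ i, z i ∈ homogPoly A m s) ∧ IsCycle (R := MvPolynomial ℕ A) MvPolynomial.X z := Iff.rfl

lemma d_X_mem {m k s : ℕ} {z : Idx m (k + 1) → MvPolynomial ℕ A}
    (hz : ∀ i, z i ∈ homogPoly A m s) (i : Idx m k) :
    dX z i ∈ homogPoly A m (s + 1) :=
  d_mem (R := MvPolynomial ℕ A) MvPolynomial.X (N := (homogPoly A m s).toAddSubgroup)
    (N' := (homogPoly A m (s + 1)).toAddSubgroup)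
    (fun _ hi _ ha => X_mul_mem_homogPoly hi ha) z hz i

/-- The differential is injective on constant coefficients in positive homological degree: the
products of constants with distinct variables cannot cancel. -/
lemma homogCycles_zero_right {m k : ℕ} {z : Idx m (k + 1) → MvPolynomial ℕ A}
    (hz : z ∈ homogCycles A m (k + 1) 0) : z = 0 := by
  induction m generalizing k with
  | zero => exact funext fun i => nomatch i
  | succ m ih =>
    obtain ⟨hz, hz'⟩ := mem_homogCycles.1 hz
    have hmem : ∀ i, z i ∈ homogPoly A m 0 := fun i => by
      rw [eq_C_of_mem_homogPoly (hz i)]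
      exact C_mem_homogPoly _ _
    have hskip : ∀ i, dX (fun j => z (.skip j)) i +
        MvPolynomial.X m * z (.take i) = 0 := fun i => congrFun hz' (.skip i)
    -- The cycle equation makes `X m * z (.take i)` minus a differential that involves only the
    -- variables before `X m`.
    have htake : ∀ i, z (.take i) = 0 := fun i => eq_zero_of_X_mul_mem (m := m) (s := 1) (by
      rw [eq_neg_of_add_eq_zero_right (hskip i)]
      exact neg_mem (d_X_mem (fun j => hmem _) i))
    have h0 := @ih k (fun j => z (.skip j)) ⟨fun i => hmem _, funext fun i => by
      simpa [htake] using hskip i⟩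
    funext i
    cases i with
    | skip i => exact congrFun h0 i
    | take i => exact htake i

/-- The cycle `z + d (h e_m)` in `m + 1` variables attached to a cycle `z` in `m` variables and a
family `h` of coefficients. -/
def cyclesStep (m k s : ℕ) :
    (homogCycles A m k (s + 1) × (Idx m k → homogPoly A (m + 1) s)) →ₗ[A]
      homogCycles A (m + 1) k (s + 1) :=
  LinearMap.codRestrict _
    ((extend (R := A)) ∘ₗ (homogCycles A m k (s + 1)).subtype ∘ₗ LinearMap.fst A _ _ +
      dX.restrictScalars A ∘ₗ joinZero ∘ₗ (homogPoly A (m + 1) s).subtype.compLeft _ ∘ₗ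
        LinearMap.snd A _ _) fun p => by
    refine mem_homogCycles.2 ⟨fun i => add_mem ?_ (d_X_mem (fun j => ?_) i),
      IsCycle.add (mem_homogCycles.1 p.1.2).2.extend (isCycle_d _ _)⟩
    · cases i with
      | skip i =>
        rw [LinearMap.comp_apply, extend_skip]
        exact homogPoly_mono (Nat.le_succ m) _ ((mem_homogCycles.1 p.1.2).1 i)
      | take i => exact zero_mem _
    · cases j with
      | skip j => exact zero_mem _
      | take j => exact (p.2 j).2

lemma coe_cyclesStep {m k s : ℕ}
    (p : homogCycles A m k (s + 1) × (Idx m k → homogPoly A (m + 1) s)) :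
    (cyclesStep m k s p).1 = extend (R := A) p.1.1 + dX (join 0 fun i => (p.2 i).1) := rfl

lemma cyclesStep_skip {m k s : ℕ}
    (p : homogCycles A m k (s + 1) × (Idx m k → homogPoly A (m + 1) s)) (i : Idx m k) :
    (cyclesStep m k s p).1 (.skip i) = p.1.1 i + MvPolynomial.X m * (p.2 i).1 := by
  rw [coe_cyclesStep, Pi.add_apply, extend_skip, d_skip]
  simp only [join_skip, join_take, smul_eq_mul]
  change _ + (dX (0 : Idx m (k + 1) → MvPolynomial ℕ A) i + _) = _
  rw [map_zero, Pi.zero_apply, zero_add]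

/-- The components without `m` read `z + X m * h` with `z` free of `X m`, and such a decomposition
of a polynomial is unique. -/
lemma cyclesStep_injective (m k s : ℕ) : Function.Injective (cyclesStep (A := A) m k s) := by
  refine (injective_iff_map_eq_zero _).2 fun p hp => ?_
  have h : ∀ i, p.1.1 i + MvPolynomial.X m * (p.2 i).1 = 0 := fun i => by
    rw [← cyclesStep_skip, hp]; rfl
  have h2 : ∀ i, (p.2 i).1 = 0 := fun i => eq_zero_of_X_mul_mem (m := m) (s := s + 1) (by
    rw [eq_neg_of_add_eq_zero_right (h i)]
    exact neg_mem ((mem_homogCycles.1 p.1.2).1 i))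
  refine Prod.ext (Subtype.ext (funext fun i => ?_)) (funext fun i => Subtype.ext (h2 i))
  simpa [h2] using h i

/-- Dividing the components without `m` by `X m` gives quotients `h`; subtracting `d (h e_m)` leaves
a cycle whose components without `m` are free of `X m`. -/
lemma cyclesStep_surjective (m k s : ℕ) : Function.Surjective (cyclesStep (A := A) m k s) := by
  intro z
  choose g hg h hh hgh using fun i => exists_eq_add_X_mul ((mem_homogCycles.1 z.2).1 (.skip i))
  -- If the components without `m` are free of `X m`, the cycle equation forces those with `m` to
  -- vanish, so the cycle already lives in `m` variables.
  have key : ∀ y ∈ homogCycles A (m + 1) k (s + 1), (∀ i, y (.skip i) = g i) →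
      y = extend (R := A) g ∧ g ∈ homogCycles A m k (s + 1) := by
    intro y hy hyg
    cases k with
    | zero =>
      refine ⟨funext fun i => ?_, hg, trivial⟩
      cases i with
      | skip i => exact hyg i
    | succ k =>
      obtain ⟨hy, hy'⟩ := mem_homogCycles.1 hy
      have hskip : ∀ i, dX g i + MvPolynomial.X m * y (.take i) = 0 := fun i => by
        rw [← funext hyg]
        exact congrFun hy' (.skip i)
      have htake : ∀ i, y (.take i) = 0 := fun i =>
        eq_zero_of_X_mul_mem (m := m) (s := s + 1 + 1) (by
          rw [eq_neg_of_add_eq_zero_right (hskip i)]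
          exact neg_mem (d_X_mem hg i))
      refine ⟨funext fun i => ?_, hg, funext fun i => by simpa [htake] using hskip i⟩
      cases i with
      | skip i => exact hyg i
      | take i => exact htake i
  let c := cyclesStep (A := A) m k s (0, fun i => ⟨h i, hh i⟩)
  obtain ⟨h1, h2⟩ := key (z - c).1 (z - c).2 fun i => by
    change z.1 _ - c.1 _ = _
    rw [cyclesStep_skip, hgh]
    change _ - ((0 : MvPolynomial ℕ A) + _) = _
    ring
  refine ⟨(⟨g, h2⟩, fun i => ⟨h i, hh i⟩), ?_⟩
  have h3 : cyclesStep (A := A) m k s (⟨g, h2⟩, 0) = z - c := by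
    apply Subtype.ext
    rw [h1]
    rw [coe_cyclesStep]
    rw [show (join 0 fun i => (((0 : Idx m k → homogPoly A (m + 1) s) i : homogPoly A (m + 1) s) :
      MvPolynomial ℕ A)) = 0 from funext fun j => by cases j <;> rfl, map_zero, add_zero]
  rw [← sub_add_cancel z c, ← h3, ← map_add]
  simp

/-- The Koszul complex of the variables is exact in positive total degree. -/
theorem exists_d_X_eq {m k s : ℕ} {z : Idx m k → MvPolynomial ℕ A}
    (hz : z ∈ homogCycles A m k (s + 1)) :
    ∃ w : Idx m (k + 1) → MvPolynomial ℕ A, (∀ i, w i ∈ homogPoly A m s) ∧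
      dX w = z := by
  induction m generalizing k with
  | zero =>
    refine ⟨0, fun _ => zero_mem _, ?_⟩
    rw [map_zero]
    exact funext fun i => (homogPoly_zero_succ s ((mem_homogCycles.1 hz).1 i)).symm
  | succ m ih =>
    obtain ⟨⟨y, h⟩, hy⟩ := cyclesStep_surjective m k s ⟨z, hz⟩
    obtain ⟨w, hw, hwy⟩ := ih y.2
    refine ⟨extend (R := A) w + join 0 (fun i => (h i).1), fun i => ?_, ?_⟩
    · cases i with
      | skip i =>
        change extend (R := A) w (.skip i) + 0 ∈ _
        rw [extend_skip, add_zero]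
        exact homogPoly_mono (Nat.le_succ m) _ (hw i)
      | take i =>
        change 0 + (h i).1 ∈ _
        rw [zero_add]
        exact (h i).2
    · have hd : dX (extend (R := A) w) = extend (R := A) (dX w) := d_extend _ w
      rw [map_add, hd, hwy]
      exact congrArg Subtype.val hy

/-- In degree zero everything is a cycle. -/
def homogCyclesZeroEquiv (m s : ℕ) : homogCycles A m 0 s ≃ₗ[A] homogPoly A m s where
  toFun z := ⟨z.1 default, (mem_homogCycles.1 z.2).1 _⟩
  map_add' _ _ := rfl
  map_smul' _ _ := rfl
  invFun f := ⟨fun _ => f.1, mem_homogCycles.2 ⟨fun _ => f.2, trivial⟩⟩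
  left_inv z := Subtype.ext (funext fun i => by rw [Unique.eq_default i])
  right_inv _ := rfl

/-- In homological degree zero the monomials form a basis, and in polynomial degree zero the higher
cycles vanish. Otherwise `cyclesStep` splits the cycles in `m + 1` variables into those in `m`
variables and a finite power of a free module. -/
instance homogCycles_free (m k s : ℕ) : Module.Free A (homogCycles A m k s) := by
  cases k with
  | zero => exact Module.Free.of_equiv (homogCyclesZeroEquiv m s).symm
  | succ k =>
    cases s with
    | zero =>
      have : Subsingleton (homogCycles A m (k + 1) 0) := ⟨fun a b => Subtype.ext (by
        rw [homogCycles_zero_right a.2, homogCycles_zero_right b.2])⟩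
      infer_instance
    | succ s =>
      induction m with
      | zero =>
        have : Subsingleton (homogCycles A 0 (k + 1) (s + 1)) :=
          ⟨fun a b => Subtype.ext (funext fun i => nomatch i)⟩
        infer_instance
      | succ m ih =>
        exact Module.Free.of_equiv (LinearEquiv.ofBijective (cyclesStep m (k + 1) s)
          ⟨cyclesStep_injective m _ s, cyclesStep_surjective m _ s⟩)

end Polynomial

/-! ### Powers of the ideal: quasi-regularity and exactness with control of coefficients. -/

section Powers

variable {R : Type*} [CommRing R]

/-- Reduction of the coefficients of a polynomial modulo `I`. -/
abbrev reduce (I : Ideal R) : MvPolynomial ℕ R →+* MvPolynomial ℕ (R ⧸ I) :=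
  MvPolynomial.map (Ideal.Quotient.mk I)

lemma reduce_eq_zero_iff {I : Ideal R} {f : MvPolynomial ℕ R} :
    reduce I f = 0 ↔ ∀ α, f.coeff α ∈ I := by
  simp only [MvPolynomial.ext_iff, MvPolynomial.coeff_map, MvPolynomial.coeff_zero,
    Ideal.Quotient.eq_zero_iff_mem]

lemma reduce_mem {I : Ideal R} {m s : ℕ} {f : MvPolynomial ℕ R} (hf : f ∈ homogPoly R m s) :
    reduce I f ∈ homogPoly (R ⧸ I) m s :=
  mem_homogPoly.2 fun α hα => mem_homogPoly.1 hf α fun h => hα (by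
    rw [MvPolynomial.coeff_map, h, map_zero])

lemma exists_reduce_eq {I : Ideal R} {m s : ℕ} {g : MvPolynomial ℕ (R ⧸ I)}
    (hg : g ∈ homogPoly (R ⧸ I) m s) : ∃ f ∈ homogPoly R m s, reduce I f = g := by
  rw [homogPoly, MvPolynomial.restrictSupport_eq_span] at hg
  induction hg using Submodule.span_induction with
  | mem g hg =>
    obtain ⟨α, hα, rfl⟩ := hg
    exact ⟨MvPolynomial.monomial α 1, (MvPolynomial.monomial_mem_restrictSupport R).2 (.inl hα), by
      simp [reduce]⟩
  | zero => exact ⟨0, zero_mem _, map_zero _⟩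
  | add g g' _ _ h h' =>
    obtain ⟨f, hf, rfl⟩ := h
    obtain ⟨f', hf', rfl⟩ := h'
    exact ⟨f + f', add_mem hf hf', map_add _ _ _⟩
  | smul a g _ h =>
    obtain ⟨f, hf, rfl⟩ := h
    obtain ⟨a, rfl⟩ := Ideal.Quotient.mk_surjective a
    exact ⟨a • f, Submodule.smul_mem _ _ hf, by
      rw [MvPolynomial.smul_eq_C_mul, map_mul, MvPolynomial.map_C, MvPolynomial.smul_eq_C_mul]⟩

lemma reduce_d {I : Ideal R} {m k : ℕ} (z : Idx m (k + 1) → MvPolynomial ℕ R) (i : Idx m k) :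
    reduce I (dX z i) = dX (fun j => reduce I (z j)) i :=
  d_map (R := MvPolynomial ℕ R) (R' := MvPolynomial ℕ (R ⧸ I)) MvPolynomial.X MvPolynomial.X
    (reduce I : MvPolynomial ℕ R →+ MvPolynomial ℕ (R ⧸ I)) (fun i _ a => by
      change reduce I (_ * _) = MvPolynomial.X i * reduce I a
      rw [map_mul, MvPolynomial.map_X]) z i

variable (x : ℕ → R)

lemma aeval_d {m k : ℕ} (z : Idx m (k + 1) → MvPolynomial ℕ R) (i : Idx m k) :
    MvPolynomial.aeval x (dX z i) = d x (fun j => MvPolynomial.aeval x (z j)) i :=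
  d_map (R := MvPolynomial ℕ R) MvPolynomial.X x
    ((MvPolynomial.aeval x : MvPolynomial ℕ R →ₐ[R] R) : MvPolynomial ℕ R →+ R) (fun i _ a => by
      change MvPolynomial.aeval x (_ * _) = x i * MvPolynomial.aeval x a
      rw [map_mul, MvPolynomial.aeval_X]) z i

/-- The ideal generated by `x 0, …, x (n - 1)`. -/
abbrev idealOf (n : ℕ) : Ideal R := Ideal.span (x '' Set.Iio n)

variable {x} {n : ℕ}

lemma mem_idealOf {i : ℕ} (hi : i < n) : x i ∈ idealOf x n :=
  Ideal.subset_span ⟨i, hi, rfl⟩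

lemma aeval_mem_mul_pow (J : Ideal R) {s : ℕ} {f : MvPolynomial ℕ R}
    (hf : f ∈ homogPoly R n s) (hJ : ∀ α, f.coeff α ∈ J) :
    MvPolynomial.aeval x f ∈ J * idealOf x n ^ s := by
  rw [MvPolynomial.aeval_def, MvPolynomial.eval₂_eq]
  refine Ideal.sum_mem _ fun α hα => Ideal.mul_mem_mul (hJ α) ?_
  obtain ⟨h1, h2⟩ := mem_homogPoly.1 hf α (MvPolynomial.mem_support_iff.1 hα)
  rw [← h1, Finsupp.degree_apply, ← Finset.prod_pow_eq_pow_sum]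
  exact Ideal.prod_mem_prod fun i hi => Ideal.pow_mem_pow (mem_idealOf (by
    by_contra h
    exact Finsupp.mem_support_iff.1 hi (h2 i (by omega)))) _

lemma aeval_mem_pow {s : ℕ} {f : MvPolynomial ℕ R} (hf : f ∈ homogPoly R n s) :
    MvPolynomial.aeval x f ∈ idealOf x n ^ s := by
  simpa using aeval_mem_mul_pow ⊤ hf fun _ => trivial

lemma aeval_mem_pow_succ {s : ℕ} {f : MvPolynomial ℕ R} (hf : f ∈ homogPoly R n s)
    (h : reduce (idealOf x n) f = 0) : MvPolynomial.aeval x f ∈ idealOf x n ^ (s + 1) := by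
  rw [pow_succ']
  exact aeval_mem_mul_pow _ hf (reduce_eq_zero_iff.1 h)

lemma exists_aeval_eq {s : ℕ} {a : R} (ha : a ∈ idealOf x n ^ s) :
    ∃ f ∈ homogPoly R n s, MvPolynomial.aeval x f = a := by
  induction s generalizing a with
  | zero => exact ⟨MvPolynomial.C a, C_mem_homogPoly _ _, by simp⟩
  | succ s ih =>
    rw [pow_succ'] at ha
    induction ha using Submodule.mul_induction_on' with
    | mem_mul_mem r hr b hb =>
      obtain ⟨f, hf, rfl⟩ := ih hb
      induction hr using Submodule.span_induction with
      | mem r hr =>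
        obtain ⟨i, hi, rfl⟩ := hr
        exact ⟨MvPolynomial.X i * f, X_mul_mem_homogPoly hi hf, by simp⟩
      | zero => exact ⟨0, zero_mem _, by simp⟩
      | add r r' _ _ h h' =>
        obtain ⟨g, hg, e⟩ := h
        obtain ⟨g', hg', e'⟩ := h'
        exact ⟨g + g', add_mem hg hg', by rw [map_add, e, e', add_mul]⟩
      | smul a r _ h =>
        obtain ⟨g, hg, e⟩ := h
        exact ⟨a • g, Submodule.smul_mem _ _ hg, by
          rw [map_smul, e, smul_eq_mul, smul_eq_mul, mul_assoc]⟩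
    | add r _ r' _ h h' =>
      obtain ⟨g, hg, e⟩ := h
      obtain ⟨g', hg', e'⟩ := h'
      exact ⟨g + g', add_mem hg hg', by rw [map_add, e, e']⟩

/-- Of the `s + 1` factors in `I`, one is absorbed into the coefficients and the other `s` become
variables. -/
lemma exists_aeval_eq_of_mem_pow_succ {s : ℕ} {a : R} (ha : a ∈ idealOf x n ^ (s + 1)) :
    ∃ f ∈ homogPoly R n s, reduce (idealOf x n) f = 0 ∧ MvPolynomial.aeval x f = a := by
  rw [pow_succ'] at ha
  induction ha using Submodule.mul_induction_on' with
  | mem_mul_mem r hr b hb =>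
    obtain ⟨f, hf, rfl⟩ := exists_aeval_eq hb
    refine ⟨r • f, Submodule.smul_mem _ _ hf, ?_, by rw [map_smul, smul_eq_mul]⟩
    rw [MvPolynomial.smul_eq_C_mul, map_mul, MvPolynomial.map_C,
      Ideal.Quotient.eq_zero_iff_mem.2 hr, map_zero, zero_mul]
  | add r _ r' _ h h' =>
    obtain ⟨g, hg, q, e⟩ := h
    obtain ⟨g', hg', q', e'⟩ := h'
    exact ⟨g + g', add_mem hg hg', by rw [map_add, q, q', add_zero], by rw [map_add, e, e']⟩

variable (x n) in
/-- A homogeneous polynomial of degree `s` that vanishes at `x` has its coefficients in the ideal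
generated by `x`. -/
def QuasiRegularAt (s : ℕ) : Prop :=
  ∀ f ∈ homogPoly R n s, MvPolynomial.aeval x f = 0 → reduce (idealOf x n) f = 0

variable (x n) in
/-- The Koszul cycles with coefficients in `I ^ (s + 1)` are boundaries of chains with coefficients
in `I ^ s`. -/
def PowExactAt (s : ℕ) : Prop :=
  ∀ (k : ℕ) (z : Idx n k → R), (∀ i, z i ∈ idealOf x n ^ (s + 1)) → IsCycle x z →
    ∃ w : Idx n (k + 1) → R, (∀ i, w i ∈ idealOf x n ^ s) ∧ d x w = z

/-- Subtracting a form with the same value and coefficients in `I` reduces to the case of value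
zero. -/
lemma QuasiRegularAt.reduce_eq_zero {s : ℕ} (h : QuasiRegularAt x n s) {f : MvPolynomial ℕ R}
    (hf : f ∈ homogPoly R n s) (hx : MvPolynomial.aeval x f ∈ idealOf x n ^ (s + 1)) :
    reduce (idealOf x n) f = 0 := by
  obtain ⟨g, hg, hg', e⟩ := exists_aeval_eq_of_mem_pow_succ hx
  have := h (f - g) (sub_mem hf hg) (by rw [map_sub, e, sub_self])
  rwa [map_sub, hg', sub_zero] at this

lemma quasiRegularAt_zero : QuasiRegularAt x n 0 := by
  intro f hf h
  rw [eq_C_of_mem_homogPoly hf] at h ⊢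
  rw [MvPolynomial.aeval_C, Algebra.algebraMap_self_apply] at h
  rw [h, map_zero, map_zero]

lemma powExactAt_zero (hx : IsWeaklyRegular x n) : PowExactAt x n 0 := by
  intro k z hz hc
  suffices ∃ w, d x w = z from this.imp fun w hw => ⟨fun i => by simp, hw⟩
  cases k with
  | zero =>
    obtain ⟨w, hw⟩ := (mem_span_iff_exists_d x).1 (by simpa using hz default)
    exact ⟨w, funext fun i => by rw [Unique.eq_default i, hw]⟩
  | succ k => exact exists_d_eq hx z hc

lemma exists_dX_eq {s : ℕ} {f : MvPolynomial ℕ R} (hf : f ∈ homogPoly R n (s + 1)) :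
    ∃ g : Idx n 1 → MvPolynomial ℕ R, (∀ i, g i ∈ homogPoly R n s) ∧ dX g default = f := by
  obtain ⟨g, hg, e⟩ := exists_d_X_eq (z := fun _ : Idx n 0 => f)
    (mem_homogCycles.2 ⟨fun _ => hf, trivial⟩)
  exact ⟨g, hg, congrFun e default⟩

lemma reduce_dX_eq_zero {I : Ideal R} {k : ℕ} {g : Idx n (k + 1) → MvPolynomial ℕ R}
    (h : ∀ i, reduce I (g i) = 0) (i : Idx n k) : reduce I (dX g i) = 0 := by
  rw [reduce_d, show (fun j => reduce I (g j)) = 0 from funext h, map_zero, Pi.zero_apply]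

/-- A linear form vanishing at `x` is a relation among the `x i`. By exactness it is a combination
of Koszul relations, whose entries lie in `I`. -/
lemma quasiRegularAt_one (hx : IsWeaklyRegular x n) : QuasiRegularAt x n 1 := by
  intro f hf h
  obtain ⟨g, hg, rfl⟩ := exists_dX_eq hf
  refine reduce_dX_eq_zero (fun i => quasiRegularAt_zero.reduce_eq_zero (hg i) ?_) _
  obtain ⟨w, hw⟩ := exists_d_eq hx (fun i => MvPolynomial.aeval x (g i)) (funext fun i => by
    rw [← aeval_d, Unique.eq_default i, h]; rfl)
  rw [← congrFun hw i]
  refine (pow_one (idealOf x n)).symm.le ?_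
  exact d_mem x (N := ⊤) (N' := (idealOf x n).toAddSubgroup)
    (fun i hi a _ => Ideal.mul_mem_right _ _ (mem_idealOf hi)) w (fun _ => trivial) i

/-- Write `f = dX g`. The values of `g` at `x` form a 1-cycle in `I ^ (s + 1)`, hence the boundary
of a chain in `I ^ s`; a polynomial lift `u` of that chain allows `g` to be replaced by `g - dX u`,
which vanishes at `x` and falls under the hypothesis. -/
lemma QuasiRegularAt.succ {s : ℕ} (h : QuasiRegularAt x n (s + 1)) (hE : PowExactAt x n s) :
    QuasiRegularAt x n (s + 2) := by
  intro f hf hf0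
  obtain ⟨g, hg, rfl⟩ := exists_dX_eq hf
  obtain ⟨w, hw, e⟩ := hE 1 (fun i => MvPolynomial.aeval x (g i)) (fun i => aeval_mem_pow (hg i))
    (funext fun i => by rw [← aeval_d, Unique.eq_default i, hf0]; rfl)
  choose u hu hu' using fun i => exists_aeval_eq (hw i)
  have hgu : dX (g - dX u) = dX g := by rw [map_sub, dX, dX, d_d, sub_zero]
  rw [← hgu]
  refine reduce_dX_eq_zero (fun i => h _ (sub_mem (hg i) (d_X_mem hu i)) ?_) _
  rw [map_sub, aeval_d, funext hu', e, sub_self]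

/-- A chain `w` in `I ^ s` bounding `z` is known. It is lifted to forms `f` of degree `s`; since `d
x w` lies in `I ^ (s + 2)`, quasi-regularity makes `f` a cycle modulo `I`. Correcting `f` by a
boundary pushes its values into `I ^ (s + 1)` without changing `d x w`. -/
lemma PowExactAt.succ {s : ℕ} (hE : PowExactAt x n s) (h : QuasiRegularAt x n (s + 1)) :
    PowExactAt x n (s + 1) := by
  intro k z hz hc
  obtain ⟨w, hw, rfl⟩ := hE k z (fun i => Ideal.pow_le_pow_right (by omega) (hz i)) hc
  choose f hf hf' using fun i => exists_aeval_eq (hw i)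
  obtain rfl : (fun i => MvPolynomial.aeval x (f i)) = w := funext hf'
  have hcyc : (fun i => reduce (idealOf x n) (f i)) ∈ homogCycles (R ⧸ idealOf x n) n (k + 1) s :=
    mem_homogCycles.2 ⟨fun i => reduce_mem (hf i), funext fun i => by
      rw [← reduce_d]
      exact h.reduce_eq_zero (d_X_mem hf i) (by rw [aeval_d]; exact hz i)⟩
  -- In polynomial degree zero a cycle need not be corrected, because in positive homological degree
  -- it is already zero modulo `I`.
  cases s with
  | zero =>
    exact ⟨_, fun i => aeval_mem_pow_succ (hf i) (congrFun (homogCycles_zero_right hcyc) i), rfl⟩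
  | succ s =>
    obtain ⟨v, hv, e⟩ := exists_d_X_eq hcyc
    choose u hu hu' using fun i => exists_reduce_eq (hv i)
    refine ⟨fun i => MvPolynomial.aeval x ((f - dX u) i),
      fun i => aeval_mem_pow_succ (sub_mem (hf i) (d_X_mem hu i)) ?_, ?_⟩
    · rw [Pi.sub_apply, map_sub, reduce_d, funext hu', e, sub_self]
    · funext i
      rw [← aeval_d, map_sub, dX, dX, d_d, sub_zero, aeval_d]

theorem powExactAt (hx : IsWeaklyRegular x n) (s : ℕ) :
    PowExactAt x n s ∧ QuasiRegularAt x n (s + 1) := by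
  induction s with
  | zero => exact ⟨powExactAt_zero hx, quasiRegularAt_one hx⟩
  | succ s ih => exact ⟨ih.1.succ ih.2, ih.2.succ ih.1⟩

theorem quasiRegularAt (hx : IsWeaklyRegular x n) : ∀ s, QuasiRegularAt x n s
  | 0 => quasiRegularAt_zero
  | s + 1 => (powExactAt hx s).2

end Powers

/-! ### Leading forms of elements and of cycles. -/

section LeadingForm

variable {R : Type*} [CommRing R] {x : ℕ → R} {n : ℕ}

variable (x n) in
/-- The evaluation at `x` of the homogeneous polynomials of degree `s`. -/
def evalPow (s : ℕ) : homogPoly R n s →ₗ[R] ↥(idealOf x n ^ s) :=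
  ((MvPolynomial.aeval x).toLinearMap.domRestrict (homogPoly R n s)).codRestrict
    ((idealOf x n ^ s).restrictScalars R) fun f => aeval_mem_pow f.2

lemma evalPow_surjective (s : ℕ) : Function.Surjective (evalPow x n s) := fun a =>
  let ⟨f, hf, e⟩ := exists_aeval_eq a.2
  ⟨⟨f, hf⟩, Subtype.ext e⟩

/-- The leading form of an element of `I ^ s`. -/
def leadingForm (hx : IsWeaklyRegular x n) (s : ℕ) :
    ↥(idealOf x n ^ s) →ₗ[R] MvPolynomial ℕ (R ⧸ idealOf x n) :=
  IdealTor.descend (evalPow x n s) (evalPow_surjective s)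
    ((MvPolynomial.mapAlgHom (Ideal.Quotient.mkₐ R (idealOf x n))).toLinearMap.domRestrict
      (homogPoly R n s))
    -- Quasi-regularity is what makes the leading form independent of the representing polynomial.
    fun f hf => quasiRegularAt hx s f.1 f.2 (congrArg Subtype.val hf)

lemma leadingForm_evalPow (hx : IsWeaklyRegular x n) {s : ℕ} (f : homogPoly R n s) :
    leadingForm hx s (evalPow x n s f) = reduce (idealOf x n) f.1 :=
  IdealTor.descend_apply _ _ _ _ _

lemma leadingForm_eq_zero_iff (hx : IsWeaklyRegular x n) {s : ℕ} (a : ↥(idealOf x n ^ s)) :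
    leadingForm hx s a = 0 ↔ (a : R) ∈ idealOf x n ^ (s + 1) := by
  obtain ⟨f, rfl⟩ := evalPow_surjective s a
  rw [leadingForm_evalPow]
  exact ⟨aeval_mem_pow_succ f.2, (quasiRegularAt hx s).reduce_eq_zero f.2⟩

lemma coe_d {I : Ideal R} {m k : ℕ} (z : Idx m (k + 1) → I) (i : Idx m k) :
    ((d x z : Idx m k → I) i : R) = d x (fun j => (z j : R)) i :=
  d_map (M := I) (M' := R) x x (I.subtype : I →+ R) (fun _ _ _ => rfl) z i

lemma IsCycle.coe {I : Ideal R} {m k : ℕ} {z : Idx m k → I} (hz : IsCycle x z) :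
    IsCycle x fun i => (z i : R) := by
  cases k with
  | zero => trivial
  | succ k =>
    refine funext fun i => ?_
    rw [← coe_d, show d x z = 0 from hz]; rfl

lemma leadingForm_mem_homogCycles (hx : IsWeaklyRegular x n) {k s : ℕ}
    {z : Idx n k → ↥(idealOf x n ^ s)} (hz : IsCycle x z) :
    (fun i => leadingForm hx s (z i)) ∈ homogCycles (R ⧸ idealOf x n) n k s := by
  choose f hf using fun i => evalPow_surjective s (z i)
  obtain rfl := funext hf
  refine mem_homogCycles.2 ⟨fun i => ?_, ?_⟩
  · rw [leadingForm_evalPow]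
    exact reduce_mem (f i).2
  · cases k with
    | zero => trivial
    | succ k =>
      refine funext fun i => ?_
      simp only [leadingForm_evalPow]
      refine (reduce_d _ i).symm.trans
        ((quasiRegularAt hx (s + 1)).reduce_eq_zero (d_X_mem (fun j => (f j).2) i) ?_)
      rw [aeval_d]
      have := congrFun hz.coe i
      exact this ▸ zero_mem _

/-- Vanishing leading forms mean coefficients in `I ^ (s + 1)`, so one direction is `PowExactAt`;
conversely, `d` multiplies coefficients by elements of `I`. -/
lemma leadingForm_eq_zero_iff_exists_d (hx : IsWeaklyRegular x n) {k s : ℕ}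
    {z : Idx n k → ↥(idealOf x n ^ s)} (hz : IsCycle x z) :
    (∀ i, leadingForm hx s (z i) = 0) ↔
      ∃ w : Idx n (k + 1) → ↥(idealOf x n ^ s), d x w = z := by
  simp only [leadingForm_eq_zero_iff]
  constructor
  · intro h
    obtain ⟨w, hw, e⟩ := (powExactAt hx s).1 k _ h hz.coe
    exact ⟨fun i => ⟨w i, hw i⟩, funext fun i => Subtype.ext (by rw [coe_d]; exact congrFun e i)⟩
  · rintro ⟨w, rfl⟩ i
    rw [coe_d]
    refine d_mem x (N := (idealOf x n ^ s).toAddSubgroup)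
      (N' := (idealOf x n ^ (s + 1)).toAddSubgroup) (fun i hi a ha => ?_) _ (fun j => (w j).2) i
    change x i * a ∈ idealOf x n ^ (s + 1)
    rw [pow_succ']
    exact Ideal.mul_mem_mul (mem_idealOf hi) ha

/-- A lift of a cycle modulo `I` need not be a cycle over `R`. In positive polynomial degree the
cycle is a boundary `dX w`, and lifting `w` instead gives a boundary over `R`, hence a true cycle.
-/
lemma exists_leadingForm_eq (hx : IsWeaklyRegular x n) {k s : ℕ}
    {y : Idx n k → MvPolynomial ℕ (R ⧸ idealOf x n)}
    (hy : y ∈ homogCycles (R ⧸ idealOf x n) n k s) :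
    ∃ z : Idx n k → ↥(idealOf x n ^ s), IsCycle x z ∧ ∀ i, leadingForm hx s (z i) = y i := by
  cases s with
  | zero =>
    cases k with
    | zero =>
      choose f hf e using fun i => exists_reduce_eq ((mem_homogCycles.1 hy).1 i)
      exact ⟨fun i => evalPow x n 0 ⟨f i, hf i⟩, trivial, fun i => by
        rw [leadingForm_evalPow, e]⟩
    | succ k =>
      exact ⟨0, isCycle_zero x, fun i => by
        rw [homogCycles_zero_right hy, Pi.zero_apply, map_zero]; rfl⟩
  | succ s =>
    obtain ⟨w, hw, rfl⟩ := exists_d_X_eq hy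
    choose f hf e using fun i => exists_reduce_eq (hw i)
    have hz : (fun i => (evalPow x n (s + 1) ⟨_, d_X_mem hf i⟩ : R)) =
        d x fun i => MvPolynomial.aeval x (f i) := funext fun i => aeval_d x f i
    refine ⟨fun i => evalPow x n (s + 1) ⟨_, d_X_mem hf i⟩, ?_, fun i => ?_⟩
    · cases k with
      | zero => trivial
      | succ k =>
        refine funext fun i => Subtype.ext ?_
        rw [coe_d, hz, d_d]; rfl
    · rw [leadingForm_evalPow, reduce_d, funext e]

end LeadingForm

/-! ### Passage from lists to sequences indexed by the natural numbers. -/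

lemma ofList_eq_idealOf {R : Type*} [CommRing R] (rs : List R) (i : ℕ) :
    Ideal.ofList (rs.take i) = idealOf (fun j => rs.getD j 0) (min i rs.length) := by
  rw [Ideal.ofList]
  congr 1
  ext r
  simp only [Set.mem_image, Set.mem_Iio, Set.mem_ofPred_eq, List.mem_iff_getElem, List.length_take]
  constructor
  · rintro ⟨j, hj, rfl⟩
    exact ⟨j, hj, by simp [List.getElem?_eq_getElem (show j < rs.length by omega)]⟩
  · rintro ⟨j, hj, rfl⟩
    exact ⟨j, hj, by simp [List.getElem?_eq_getElem (show j < rs.length by omega)]⟩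

lemma isWeaklyRegular_getD {R : Type*} [CommRing R] {rs : List R}
    (h : RingTheory.Sequence.IsWeaklyRegular R rs) :
    IsWeaklyRegular (fun j => rs.getD j 0) rs.length := by
  intro i hi b hb
  have h1 := h.regular_mod_prev i hi
  rw [smul_eq_mul, Ideal.mul_top, ofList_eq_idealOf, min_eq_left hi.le] at h1
  rw [← Ideal.Quotient.eq_zero_iff_mem] at hb ⊢
  refine h1.right_eq_zero_of_smul ?_
  rw [← hb]
  simp only [List.getD_eq_getElem _ _ hi]
  rfl

/-! ### Tensoring the Koszul complex with a module. -/

section Coefficients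

variable {R : Type*} [CommRing R] (x : ℕ → R) {N N' : Type*} [AddCommGroup N] [AddCommGroup N']
  [Module R N] [Module R N'] {n k : ℕ}

variable (N n k) in
/-- Families in `N` as families in `R` with coefficients in `N`. -/
def coeffEquiv : (Idx n k → R) ⊗[R] N ≃ₗ[R] (Idx n k → N) :=
  TensorProduct.comm R (Idx n k → R) N ≪≫ₗ TensorProduct.piScalarRight R R N (Idx n k)

lemma coeffEquiv_tmul (z : Idx n k → R) (a : N) :
    coeffEquiv N n k (z ⊗ₜ[R] a) = fun i => z i • a := rfl

lemma coeffEquiv_rTensor (c : (Idx n (k + 1) → R) ⊗[R] N) :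
    coeffEquiv N n k ((d x).rTensor N c) = d x (coeffEquiv N n (k + 1) c) := by
  induction c using TensorProduct.induction_on with
  | zero => simp
  | add c c' h h' => simp only [map_add, h, h']
  | tmul z a =>
    rw [LinearMap.rTensor_tmul, coeffEquiv_tmul, coeffEquiv_tmul]
    exact funext fun i => d_map x x (LinearMap.toSpanSingleton R N a : R →+ N)
      (fun i _ b => by simp [mul_smul]) z i

lemma coeffEquiv_lTensor (f : N →ₗ[R] N') (c : (Idx n k → R) ⊗[R] N) (i : Idx n k) :
    coeffEquiv N' n k (f.lTensor (Idx n k → R) c) i = f (coeffEquiv N n k c i) := by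
  induction c using TensorProduct.induction_on with
  | zero => simp
  | add c c' h h' => simp only [map_add, Pi.add_apply, h, h']
  | tmul z a => rw [LinearMap.lTensor_tmul, coeffEquiv_tmul, coeffEquiv_tmul, map_smul]

end Coefficients

/-! ### The Koszul resolution of `R / I` and its homology with coefficients in `I ^ s`. -/

section Resolution

variable {R : Type u} [CommRing R] (x : ℕ → R) (n : ℕ)

/-- The Koszul complex of `x 0, …, x (n - 1)`. -/
def koszulComplex : ChainComplex (ModuleCat.{u} R) ℕ :=
  ChainComplex.of (fun k => ModuleCat.of R (Idx n k → R)) (fun _ => ModuleCat.ofHom (d x))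
    fun _ => ModuleCat.hom_ext (LinearMap.ext fun z => d_d x z)

lemma koszulComplex_d (k : ℕ) : (koszulComplex x n).d (k + 1) k = ModuleCat.ofHom (d x) :=
  ChainComplex.of_d (fun k => ModuleCat.of R (Idx n k → R)) (fun _ => ModuleCat.ofHom (d x)) k

instance (k : ℕ) : Projective ((koszulComplex x n).X k) :=
  have : Module.Projective R (ModuleCat.of R (Idx n k → R)) :=
    inferInstanceAs (Module.Projective R (Idx n k → R))
  ModuleCat.projective_of_categoryTheory_projective (ModuleCat.of R (Idx n k → R))

/-- The augmentation of the Koszul complex. -/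
def koszulAugmentation : (koszulComplex x n).X 0 ⟶ ModuleCat.of R (R ⧸ idealOf x n) :=
  ModuleCat.ofHom ((idealOf x n).mkQ ∘ₗ LinearMap.proj default : (Idx n 0 → R) →ₗ[R] _)

lemma koszulAugmentation_eq_zero_iff (z : Idx n 0 → R) :
    (koszulAugmentation x n).hom z = 0 ↔ ∃ w : Idx n 1 → R, d x w = z := by
  change Submodule.Quotient.mk (z default) = (0 : R ⧸ idealOf x n) ↔ _
  rw [Submodule.Quotient.mk_eq_zero, mem_span_iff_exists_d]
  exact exists_congr fun w => ⟨fun h => funext fun i => by rw [Unique.eq_default i, h],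
    fun h => by rw [h]⟩

lemma koszulComplex_d_augmentation : (koszulComplex x n).d 1 0 ≫ koszulAugmentation x n = 0 := by
  rw [koszulComplex_d]
  exact ModuleCat.hom_ext (LinearMap.ext fun w =>
    (koszulAugmentation_eq_zero_iff x n _).2 ⟨w, rfl⟩)

variable {x n}

lemma koszulComplex_exactAt (hx : IsWeaklyRegular x n) (k : ℕ) :
    (koszulComplex x n).ExactAt (k + 1) := by
  rw [HomologicalComplex.exactAt_iff' _ (k + 2) (k + 1) k (by simp) (by simp),
    ShortComplex.moduleCat_exact_iff]
  intro z hz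
  change ((koszulComplex x n).d (k + 1) k).hom z = 0 at hz
  rw [koszulComplex_d] at hz
  obtain ⟨w, hw⟩ := exists_d_eq hx z hz
  refine ⟨w, ?_⟩
  change ((koszulComplex x n).d (k + 1 + 1) (k + 1)).hom w = z
  rw [koszulComplex_d]
  exact hw

/-- The Koszul complex of a weakly regular sequence is a projective resolution. -/
def koszulResolution (hx : IsWeaklyRegular x n) :
    ProjectiveResolution (ModuleCat.of R (R ⧸ idealOf x n)) where
  complex := koszulComplex x n
  π := (ChainComplex.toSingle₀Equiv _ _).symm
    ⟨koszulAugmentation x n, koszulComplex_d_augmentation x n⟩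
  quasiIso := ⟨fun k => by
    cases k with
    | zero =>
      rw [ChainComplex.quasiIsoAt₀_iff, ShortComplex.quasiIso_iff_of_zeros']
      · refine ⟨(ShortComplex.moduleCat_exact_iff _).2 fun z hz => ?_,
          (ModuleCat.epi_iff_surjective _).2 fun a => ?_⟩
        · change (((ChainComplex.toSingle₀Equiv _ _).symm
            ⟨koszulAugmentation x n, koszulComplex_d_augmentation x n⟩).f 0).hom z = 0 at hz
          rw [ChainComplex.toSingle₀Equiv_symm_apply_f_zero] at hz
          obtain ⟨w, hw⟩ := (koszulAugmentation_eq_zero_iff x n z).1 hz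
          refine ⟨w, ?_⟩
          change ((koszulComplex x n).d (0 + 1) 0).hom w = z
          rw [koszulComplex_d]
          exact hw
        · change ∃ z, (((ChainComplex.toSingle₀Equiv _ _).symm
            ⟨koszulAugmentation x n, koszulComplex_d_augmentation x n⟩).f 0).hom z = a
          rw [ChainComplex.toSingle₀Equiv_symm_apply_f_zero]
          obtain ⟨b, hb⟩ := Submodule.Quotient.mk_surjective (idealOf x n) a
          exact ⟨fun _ => b, hb⟩
      · exact (koszulComplex x n).shape _ _ (by simp)
      all_goals rfl
    | succ k =>
      rw [quasiIsoAt_iff_exactAt']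
      · exact koszulComplex_exactAt hx k
      · apply ChainComplex.exactAt_succ_single_obj⟩

/-- The tensor product of the Koszul complex with a module. -/
abbrev koszulTensor (x : ℕ → R) (n : ℕ) (N : ModuleCat.{u} R) : ChainComplex (ModuleCat.{u} R) ℕ :=
  (((tensoringRight (ModuleCat.{u} R)).obj N).mapHomologicalComplex _).obj (koszulComplex x n)

/-- The map of Koszul complexes induced by a map of coefficients. -/
abbrev koszulTensorMap (x : ℕ → R) (n : ℕ) {N N' : ModuleCat.{u} R} (f : N ⟶ N') :
    koszulTensor x n N ⟶ koszulTensor x n N' :=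
  (NatTrans.mapHomologicalComplex ((tensoringRight (ModuleCat.{u} R)).map f) _).app
    (koszulComplex x n)

/-- The terms of the Koszul complex with coefficients. -/
def termEquiv (x : ℕ → R) (n : ℕ) (N : ModuleCat.{u} R) (k : ℕ) :
    (koszulTensor x n N).X k ≃ₗ[R] (Idx n k → N) :=
  coeffEquiv N n k

lemma termEquiv_d (N : ModuleCat.{u} R) {k : ℕ} (c : (koszulTensor x n N).X (k + 1)) :
    termEquiv x n N k (((koszulTensor x n N).d (k + 1) k).hom c) = d x (termEquiv x n N _ c) := by
  have hd : ((koszulTensor x n N).d (k + 1) k) = ModuleCat.ofHom (d x) ▷ N := by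
    change ((koszulComplex x n).d (k + 1) k ▷ N) = _
    rw [koszulComplex_d]; rfl
  rw [hd]
  exact coeffEquiv_rTensor x c

lemma termEquiv_map {N N' : ModuleCat.{u} R} (f : N ⟶ N') {k : ℕ}
    (c : (koszulTensor x n N).X k) (i : Idx n k) :
    termEquiv x n N' k (((koszulTensorMap x n f).f k).hom c) i =
      f.hom (termEquiv x n N k c i) :=
  coeffEquiv_lTensor f.hom c i

/-- The condition on `j` is vacuous for `k = 0`, where every chain is a cycle. -/
lemma exists_iCycles_eq (K : ChainComplex (ModuleCat.{u} R) ℕ) {k : ℕ} (c : K.X k)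
    (hc : ∀ j, j + 1 = k → (K.d k j).hom c = 0) : ∃ z, (K.iCycles k).hom z = c := by
  have hex := (ShortComplex.moduleCat_exact_iff _).1
    (ShortComplex.exact_of_f_is_kernel (ShortComplex.mk _ _
      (K.iCycles_d k ((ComplexShape.down ℕ).next k))) (K.cyclesIsKernel k _ rfl))
  refine hex c ?_
  change (K.d k ((ComplexShape.down ℕ).next k)).hom c = 0
  by_cases h : (ComplexShape.down ℕ).Rel k ((ComplexShape.down ℕ).next k)
  · exact hc _ h
  · rw [K.shape _ _ h]; rfl

lemma isCycle_termEquiv {N : ModuleCat.{u} R} {k : ℕ} (z : (koszulTensor x n N).cycles k) :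
    IsCycle x (termEquiv x n N k (((koszulTensor x n N).iCycles k).hom z)) := by
  cases k with
  | zero => trivial
  | succ k => exact (termEquiv_d N _).symm.trans (by rw [IdealTor.d_iCycles, map_zero])

lemma exists_termEquiv_eq {N : ModuleCat.{u} R} {k : ℕ} {z : Idx n k → N} (hz : IsCycle x z) :
    ∃ c, termEquiv x n N k (((koszulTensor x n N).iCycles k).hom c) = z := by
  obtain ⟨c, hc⟩ := exists_iCycles_eq _ ((termEquiv x n N k).symm z) (by
    rintro j rfl
    apply (termEquiv x n N j).injective
    rw [termEquiv_d, LinearEquiv.apply_symm_apply, map_zero]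
    exact hz)
  exact ⟨c, by rw [hc, LinearEquiv.apply_symm_apply]⟩

lemma homologyπ_koszul_eq_zero_iff {N : ModuleCat.{u} R} {k : ℕ}
    (z : (koszulTensor x n N).cycles k) :
    ((koszulTensor x n N).homologyπ k).hom z = 0 ↔ ∃ w : Idx n (k + 1) → N,
      d x w = termEquiv x n N k (((koszulTensor x n N).iCycles k).hom z) := by
  rw [IdealTor.homologyπ_eq_zero_iff, ← (termEquiv x n N (k + 1)).toEquiv.exists_congr_right]
  refine exists_congr fun w => ?_
  change _ ↔ d x (termEquiv x n N (k + 1) w) = _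
  rw [← termEquiv_d, (termEquiv x n N k).injective.eq_iff]

/-- The inclusion of `I ^ (s + 1)` into `I ^ s`. -/
def powIncl (I : Ideal R) (s : ℕ) : IdealTor.powMod I (s + 1) ⟶ IdealTor.powMod I s :=
  ModuleCat.ofHom (Submodule.inclusion (Ideal.pow_le_pow_right (Nat.le_succ s)))

/-- This is `PowExactAt` in terms of homology: a cycle in `I ^ (s + 1)` becomes a boundary once
chains in `I ^ s` are allowed. -/
lemma homologyMap_koszulTensorMap_powIncl (hx : IsWeaklyRegular x n) (s k : ℕ) :
    HomologicalComplex.homologyMap (koszulTensorMap x n (powIncl (idealOf x n) s)) k = 0 := by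
  rw [← cancel_epi ((koszulTensor x n _).homologyπ k), HomologicalComplex.homologyπ_naturality,
    comp_zero]
  refine ModuleCat.hom_ext (LinearMap.ext fun z => ?_)
  refine (homologyπ_koszul_eq_zero_iff
    ((HomologicalComplex.cyclesMap (koszulTensorMap x n (powIncl _ s)) k).hom z)).2 ?_
  have hz := isCycle_termEquiv z
  obtain ⟨w, hw, e⟩ := (powExactAt hx s).1 k _
    (fun i => Subtype.prop (p := (· ∈ idealOf x n ^ (s + 1)))
      (termEquiv x n (IdealTor.powMod (idealOf x n) (s + 1)) k _ i)) hz.coe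
  refine ⟨fun i => ⟨w i, hw i⟩, funext fun i => Subtype.ext ?_⟩
  rw [coe_d]
  refine (congrFun e i).trans ?_
  have h : ((koszulTensor x n (IdealTor.powMod (idealOf x n) s)).iCycles k).hom
      ((HomologicalComplex.cyclesMap (koszulTensorMap x n (powIncl (idealOf x n) s)) k).hom z) =
      ((koszulTensorMap x n (powIncl (idealOf x n) s)).f k).hom
        (((koszulTensor x n _).iCycles k).hom z) :=
    congrArg (fun f => f.hom z) (HomologicalComplex.cyclesMap_i
      (koszulTensorMap x n (powIncl (idealOf x n) s)) k)
  rw [h, termEquiv_map]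
  rfl

/-- The leading forms of the cycles with coefficients in `I ^ s`. -/
def cyclesLeadingForm (hx : IsWeaklyRegular x n) (s k : ℕ) :
    (koszulTensor x n (IdealTor.powMod (idealOf x n) s)).cycles k →ₗ[R]
      homogCycles (R ⧸ idealOf x n) n k s :=
  (((leadingForm hx s).compLeft (Idx n k)) ∘ₗ
    (termEquiv x n (IdealTor.powMod (idealOf x n) s) k).toLinearMap ∘ₗ
      ((koszulTensor x n (IdealTor.powMod (idealOf x n) s)).iCycles k).hom).codRestrict
    ((homogCycles (R ⧸ idealOf x n) n k s).restrictScalars R)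
    fun z => leadingForm_mem_homogCycles hx (isCycle_termEquiv z)

lemma cyclesLeadingForm_eq_zero_iff (hx : IsWeaklyRegular x n) {s k : ℕ}
    (z : (koszulTensor x n (IdealTor.powMod (idealOf x n) s)).cycles k) :
    cyclesLeadingForm hx s k z = 0 ↔
      ((koszulTensor x n (IdealTor.powMod (idealOf x n) s)).homologyπ k).hom z = 0 := by
  rw [homologyπ_koszul_eq_zero_iff, ← leadingForm_eq_zero_iff_exists_d hx (isCycle_termEquiv z),
    Subtype.ext_iff, funext_iff]
  rfl

lemma cyclesLeadingForm_surjective (hx : IsWeaklyRegular x n) (s k : ℕ) :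
    Function.Surjective (cyclesLeadingForm hx s k) := by
  rintro ⟨y, hy⟩
  obtain ⟨z, hz, e⟩ := exists_leadingForm_eq hx hy
  obtain ⟨c, rfl⟩ := exists_termEquiv_eq (N := IdealTor.powMod (idealOf x n) s) hz
  exact ⟨c, Subtype.ext (funext e)⟩

/-- The homology of the Koszul complex with coefficients in `I ^ s`. -/
def homologyEquiv (hx : IsWeaklyRegular x n) (s k : ℕ) :
    (koszulTensor x n (IdealTor.powMod (idealOf x n) s)).homology k ≃ₗ[R]
      homogCycles (R ⧸ idealOf x n) n k s :=
  LinearEquiv.ofBijective (IdealTor.descend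
    ((koszulTensor x n (IdealTor.powMod (idealOf x n) s)).homologyπ k).hom
    (IdealTor.homologyπ_surjective _ k) (cyclesLeadingForm hx s k)
    fun z => (cyclesLeadingForm_eq_zero_iff hx z).2) (by
  constructor
  · refine (injective_iff_map_eq_zero _).2 fun h hh => ?_
    obtain ⟨z, rfl⟩ := IdealTor.homologyπ_surjective _ k h
    rw [IdealTor.descend_apply] at hh
    exact (cyclesLeadingForm_eq_zero_iff hx z).1 hh
  · intro y
    obtain ⟨z, rfl⟩ := cyclesLeadingForm_surjective hx s k y
    exact ⟨_, IdealTor.descend_apply _ _ _ _ z⟩)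

end Resolution

end Koszul

/-! ### Transfer to Tor, and the exact sequence. -/

namespace IdealTor

open Koszul

variable {R : Type u} [CommRing R]

lemma torMap_eq (k : ℕ) (M : ModuleCat.{u} R) {N N' : ModuleCat.{u} R} (f : N ⟶ N') :
    torMap k M f = (torIso k M N).hom ≫
      HomologicalComplex.homologyMap (torComplexMap M f) k ≫ (torIso k M N').inv :=
  ProjectiveResolution.leftDerived_app_eq ((tensoringRight (ModuleCat.{u} R)).map f)
    (projectiveResolution M) k

variable {x : ℕ → R} {n : ℕ}

/-- `Tor_k(R/I, N)` is the homology of the Koszul complex with coefficients in `N`. -/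
def torIsoKoszul (hx : IsWeaklyRegular x n) (k : ℕ) (N : ModuleCat.{u} R) :
    tor k (ModuleCat.of R (R ⧸ idealOf x n)) N ≅ (koszulTensor x n N).homology k :=
  (koszulResolution hx).isoLeftDerivedObj ((tensoringRight (ModuleCat.{u} R)).obj N) k

lemma torMap_eq_koszul (hx : IsWeaklyRegular x n) (k : ℕ) {N N' : ModuleCat.{u} R} (f : N ⟶ N') :
    torMap k (ModuleCat.of R (R ⧸ idealOf x n)) f = (torIsoKoszul hx k N).hom ≫
      HomologicalComplex.homologyMap (koszulTensorMap x n f) k ≫ (torIsoKoszul hx k N').inv :=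
  ProjectiveResolution.leftDerived_app_eq ((tensoringRight (ModuleCat.{u} R)).map f)
    (koszulResolution hx) k

lemma torMap_powIncl (hx : IsWeaklyRegular x n) (s k : ℕ) :
    torMap k (ModuleCat.of R (R ⧸ idealOf x n)) (powIncl (idealOf x n) s) = 0 := by
  rw [torMap_eq_koszul hx, homologyMap_koszulTensorMap_powIncl hx, zero_comp, comp_zero]

/-- The connecting map and the product are defined on the chosen resolution, whereas the vanishing
was computed on the Koszul one; both compute the same map on Tor. -/
lemma homologyMap_torComplexMap_powIncl (hx : IsWeaklyRegular x n) (s k : ℕ) :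
    HomologicalComplex.homologyMap
      (torComplexMap (ModuleCat.of R (R ⧸ idealOf x n)) (powIncl (idealOf x n) s)) k = 0 := by
  have h := torMap_powIncl hx s k
  rw [torMap_eq] at h
  rw [← cancel_epi (torIso k _ _).hom, ← cancel_mono (torIso k _ _).inv, Category.assoc, h]
  simp

/-- The sequence `I ^ (s + 1) ⟶ I ^ s ⟶ I ^ s / I ^ (s + 1)`. -/
def powInclSeq (I : Ideal R) (s : ℕ) : ShortComplex (ModuleCat.{u} R) :=
  ShortComplex.mk (powIncl I s) (powProj I s) (ModuleCat.hom_ext (LinearMap.ext fun a =>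
    (Submodule.Quotient.mk_eq_zero _).2 a.2))

lemma powInclSeq_shortExact (I : Ideal R) (s : ℕ) : (powInclSeq I s).ShortExact where
  exact := (ShortComplex.moduleCat_exact_iff _).2 fun a ha =>
    ⟨⟨_, (Submodule.Quotient.mk_eq_zero
      (Submodule.comap (Submodule.subtype (I ^ s)) (I ^ (s + 1))) (x := a)).1 ha⟩, rfl⟩
  mono_f := (ModuleCat.mono_iff_injective _).2 (Submodule.inclusion_injective
    (Ideal.pow_le_pow_right (Nat.le_succ s)))
  epi_g := (ModuleCat.epi_iff_surjective _).2 (Submodule.mkQ_surjective _)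

/-- The map from the sequence `I ^ (s + 1) ⟶ I ^ s ⟶ I ^ s / I ^ (s + 1)` to the sequence
`I ^ (s + 1) / I ^ (s + 2) ⟶ I ^ s / I ^ (s + 2) ⟶ I ^ s / I ^ (s + 1)`. -/
def powInclSeqToPowSeq (I : Ideal R) (s : ℕ) : powInclSeq I s ⟶ powSeq I s where
  τ₁ := powProj I (s + 1)
  τ₂ := ModuleCat.ofHom (Submodule.mkQ _)
  τ₃ := 𝟙 _
  comm₁₂ := ModuleCat.hom_ext (LinearMap.ext fun _ => rfl)
  comm₂₃ := ModuleCat.hom_ext (LinearMap.ext fun _ => rfl)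

/-- The map of sequences of complexes induced by a map of sequences of modules. -/
def torShortComplexMap (M : ModuleCat.{u} R) {S T : ShortComplex (ModuleCat.{u} R)} (φ : S ⟶ T) :
    torShortComplex M S ⟶ torShortComplex M T where
  τ₁ := torComplexMap M φ.τ₁
  τ₂ := torComplexMap M φ.τ₂
  τ₃ := torComplexMap M φ.τ₃
  comm₁₂ := by
    ext i : 1
    change ((resolution M).X i ◁ φ.τ₁) ≫ ((resolution M).X i ◁ T.f) =
      ((resolution M).X i ◁ S.f) ≫ ((resolution M).X i ◁ φ.τ₂)
    rw [← MonoidalCategory.whiskerLeft_comp, ← MonoidalCategory.whiskerLeft_comp, φ.comm₁₂]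
  comm₂₃ := by
    ext i : 1
    change ((resolution M).X i ◁ φ.τ₂) ≫ ((resolution M).X i ◁ T.g) =
      ((resolution M).X i ◁ S.g) ≫ ((resolution M).X i ◁ φ.τ₃)
    rw [← MonoidalCategory.whiskerLeft_comp, ← MonoidalCategory.whiskerLeft_comp, φ.comm₂₃]

lemma conj_comp_eq_conj_comp {C : Type*} [Category* C] {A A' B B' D D' E E' : C} (α : A ≅ A')
    (β : B ≅ B') (γ : D ≅ D') (ε : E ≅ E') {δ : A' ⟶ B'} {f : B' ⟶ D'} {g : A' ⟶ E'}
    {δ' : E' ⟶ D'} (h : δ ≫ f = g ≫ δ') :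
    (α.hom ≫ δ ≫ β.inv) ≫ β.hom ≫ f ≫ γ.inv = (α.hom ≫ g ≫ ε.inv) ≫ ε.hom ≫ δ' ≫ γ.inv := by
  simp only [Category.assoc, Iso.inv_hom_id_assoc]
  rw [reassoc_of% h]

lemma torδ_naturality (k : ℕ) (M : ModuleCat.{u} R) {S T : ShortComplex (ModuleCat.{u} R)}
    (hS : S.ShortExact) (hT : T.ShortExact) (φ : S ⟶ T) :
    torδ k M hS ≫ torMap k M φ.τ₁ = torMap (k + 1) M φ.τ₃ ≫ torδ k M hT := by
  rw [torMap_eq, torMap_eq]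
  exact conj_comp_eq_conj_comp (torIso (k + 1) M S.X₃) (torIso k M S.X₁) (torIso k M T.X₁)
    (torIso (k + 1) M T.X₃) (HomologicalComplex.HomologySequence.δ_naturality
      (torShortComplexMap M φ) (torShortComplex_shortExact M hS) (torShortComplex_shortExact M hT)
      (k + 1) k (by simp))

lemma torδ_exact (k : ℕ) (M : ModuleCat.{u} R) {S : ShortComplex (ModuleCat.{u} R)}
    (hS : S.ShortExact) :
    Function.Exact (torMap (k + 1) M S.g).hom (torδ k M hS).hom := by
  have h := (ShortComplex.ShortExact.moduleCat_exact_iff_function_exact _).1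
    ((torShortComplex_shortExact M hS).homology_exact₃ (k + 1) k (by simp))
  rw [torMap_eq]
  intro y
  have hinj := ((torIso k M S.X₁).symm.toLinearEquiv).injective
  refine Iff.trans ?_ ((h ((torIso (k + 1) M S.X₃).hom.hom y)).trans ?_)
  · exact map_eq_zero_iff (torIso k M S.X₁).symm.toLinearEquiv hinj
  · constructor
    · rintro ⟨w, hw⟩
      refine ⟨(torIso (k + 1) M S.X₂).inv.hom w, ?_⟩
      refine (congrArg (fun v => (torIso (k + 1) M S.X₃).inv.hom ((HomologicalComplex.homologyMap
        (torComplexMap M S.g) (k + 1)).hom v))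
          (Iso.inv_hom_id_apply (torIso (k + 1) M S.X₂) w)).trans ?_
      exact (congrArg (torIso (k + 1) M S.X₃).inv.hom hw).trans
        (Iso.hom_inv_id_apply (torIso (k + 1) M S.X₃) y)
    · rintro ⟨w, rfl⟩
      exact ⟨(torIso (k + 1) M S.X₂).hom.hom w,
        (Iso.inv_hom_id_apply (torIso (k + 1) M S.X₃) _).symm⟩

lemma torPowProj_injective (hx : IsWeaklyRegular x n) (s k : ℕ) :
    Function.Injective (torPowProj (idealOf x n) s k).hom := by
  rw [← ModuleCat.mono_iff_injective]
  have h : Mono (HomologicalComplex.homologyMap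
      (torComplexMap (ModuleCat.of R (R ⧸ idealOf x n)) (powProj (idealOf x n) s)) k) :=
    ((torShortComplex_shortExact (ModuleCat.of R (R ⧸ idealOf x n))
      (powInclSeq_shortExact (idealOf x n) s)).homology_exact₂ k).mono_g
      (homologyMap_torComplexMap_powIncl hx s k)
  rw [torPowProj, torMap_eq]
  infer_instance

/-- Right exactness of the tensor product; this is the case `k = 0` of exactness at the middle term,
where `Tor_{-1} = 0`. -/
lemma torMap_zero_surjective (M : ModuleCat.{u} R) {N N' : ModuleCat.{u} R} (f : N ⟶ N')
    (hf : Function.Surjective f.hom) : Function.Surjective (torMap 0 M f).hom := by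
  rw [← ModuleCat.epi_iff_surjective, torMap_eq]
  have h : Epi (HomologicalComplex.homologyMap (torComplexMap M f) 0) := by
    refine (ModuleCat.epi_iff_surjective _).2 fun y => ?_
    obtain ⟨z, rfl⟩ := homologyπ_surjective _ 0 y
    obtain ⟨c, hc⟩ := LinearMap.lTensor_surjective ((resolution M).X 0) hf
      (((torComplex M N').iCycles 0).hom z)
    obtain ⟨w, rfl⟩ := exists_iCycles_eq (torComplex M N) c (fun j hj => by omega)
    refine ⟨((torComplex M N).homologyπ 0).hom w, ?_⟩
    have h1 := congrArg (fun g => g.hom w)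
      (HomologicalComplex.homologyπ_naturality (torComplexMap M f) 0)
    refine h1.trans (congrArg ((torComplex M N').homologyπ 0).hom ?_)
    apply (ModuleCat.mono_iff_injective ((torComplex M N').iCycles 0)).1 inferInstance
    exact (congrArg (fun g => g.hom w)
      (HomologicalComplex.cyclesMap_i (torComplexMap M f) 0)).trans hc
  infer_instance

/-- Naturality of the connecting map along `powInclSeqToPowSeq`, which is the identity on the
quotient `I ^ s / I ^ (s + 1)`. -/
lemma torPowδ_eq (I : Ideal R) (s k : ℕ) :
    torPowδ I s k = torδ k (ModuleCat.of R (R ⧸ I)) (powInclSeq_shortExact I s) ≫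
      torPowProj I (s + 1) k := by
  refine Eq.symm ((torδ_naturality k _ (powInclSeq_shortExact I s) (powSeq_shortExact I s)
    (powInclSeqToPowSeq I s)).trans ?_)
  have h : torMap (k + 1) (ModuleCat.of R (R ⧸ I)) (𝟙 (powQuot I s (s + 1))) = 𝟙 _ :=
    ((Tor' (ModuleCat.{u} R) (k + 1)).obj (ModuleCat.of R (R ⧸ I))).map_id _
  exact (congrArg (· ≫ _) h).trans (Category.id_comp _)

/-- The second factor of `torPowδ_eq` is injective, so the kernel is that of the connecting map of
`powInclSeq`. -/
lemma torPowδ_exact (hx : IsWeaklyRegular x n) (s k : ℕ) :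
    Function.Exact (torPowProj (idealOf x n) s (k + 1)).hom (torPowδ (idealOf x n) s k).hom := by
  intro y
  rw [torPowδ_eq]
  exact (map_eq_zero_iff _ (torPowProj_injective hx (s + 1) k)).trans
    (torδ_exact k (ModuleCat.of R (R ⧸ idealOf x n)) (powInclSeq_shortExact (idealOf x n) s) y)

lemma free_tor_powMod (hx : IsWeaklyRegular x n) (s k : ℕ) :
    Module.Free (R ⧸ idealOf x n)
      (tor k (ModuleCat.of R (R ⧸ idealOf x n)) (powMod (idealOf x n) s)) := by
  have : IsScalarTower R (R ⧸ idealOf x n)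
      (tor k (ModuleCat.of R (R ⧸ idealOf x n)) (powMod (idealOf x n) s)) :=
    (isTorsionBySet_tor (idealOf x n) k (powMod (idealOf x n) s)).isScalarTower
  -- The isomorphism with the homogeneous cycles is `R`-linear, hence linear over `R / I` because
  -- `R` surjects onto it.
  exact Module.Free.of_equiv (LinearEquiv.extendScalarsOfSurjective
    (S := R ⧸ idealOf x n) Ideal.Quotient.mk_surjective
    ((torIsoKoszul hx k (powMod (idealOf x n) s)).toLinearEquiv ≪≫ₗ homologyEquiv hx s k)).symm

/-! ### Vanishing of the products. -/

lemma map₂_compr₂ {P₁ P₂ P₃ N N' : Type*} [AddCommGroup P₁] [AddCommGroup P₂] [AddCommGroup P₃]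
    [AddCommGroup N] [AddCommGroup N'] [Module R P₁] [Module R P₂] [Module R P₃] [Module R N]
    [Module R N'] (m : P₁ →ₗ[R] P₂ →ₗ[R] P₃) (ν : N →ₗ[R] N →ₗ[R] N') (f : N' →ₗ[R] N)
    (a : P₁ ⊗[R] N) (b : P₂ ⊗[R] N) :
    TensorProduct.map₂ m (ν.compr₂ f) a b = f.lTensor P₃ (TensorProduct.map₂ m ν a b) := by
  induction a using TensorProduct.induction_on with
  | zero => simp
  | add a a' h h' => simp only [map_add, LinearMap.add_apply, h, h']
  | tmul p a =>
    induction b using TensorProduct.induction_on with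
    | zero => simp
    | add b b' h h' => simp only [map_add, h, h']
    | tmul q b => simp

/-- A product on `Tor(M, N)` vanishes if the product on `N` factors through an injective map
`N' ⟶ N` that is zero on `Tor(M, -)`. -/
lemma torMul_eq_zero (M : ModuleCat.{u} R) {N N' : ModuleCat.{u} R} (μ : M →ₗ[R] M →ₗ[R] M)
    (f : N' ⟶ N) (hf : Function.Injective f.hom) (ν : N →ₗ[R] N →ₗ[R] N') (i j : ℕ)
    (h : HomologicalComplex.homologyMap (torComplexMap M f) (i + j) = 0) :
    torMul M N μ (ν.compr₂ f.hom) i j = 0 := by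
  suffices homologyMul M N μ (ν.compr₂ f.hom) i j = 0 by
    rw [torMul, this]
    ext a b
    exact map_zero (torIso (i + j) M N).inv.hom
  ext a b
  obtain ⟨a, rfl⟩ := homologyπ_surjective _ i a
  obtain ⟨b, rfl⟩ := homologyπ_surjective _ j b
  rw [homologyMul_homologyπ]
  -- The product of the two cycles, formed already with coefficients in `N'`.
  let c : (torComplex M N').X (i + j) := TensorProduct.map₂ (resMul M μ i j (i + j)) ν
    (((torComplex M N).iCycles i).hom a) (((torComplex M N).iCycles j).hom b)
  have hc : ((torComplexMap M f).f (i + j)).hom c = ((torComplex M N).iCycles (i + j)).hom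
      (cyclesMul M N μ (ν.compr₂ f.hom) i j (i + j) rfl a b) := by
    rw [iCycles_cyclesMul]
    exact (map₂_compr₂ _ ν f.hom _ _).symm
  have hinj : ∀ l, Function.Injective ((torComplexMap M f).f l).hom := fun l =>
    Module.Flat.lTensor_preserves_injective_linearMap (M := (resolution M).X l) f.hom hf
  -- The image of `c` in `P ⊗ N` is a cycle, and `P ⊗ N' → P ⊗ N` is injective by flatness, so `c`
  -- is itself a cycle. The product class is thus in the image of the zero map on homology.
  obtain ⟨z, hz⟩ := exists_iCycles_eq (torComplex M N') c fun l _ => hinj l (by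
    rw [map_zero]
    refine (congrArg (fun g => g.hom c) ((torComplexMap M f).comm (i + j) l)).symm.trans ?_
    exact (congrArg ((torComplex M N).d (i + j) l).hom hc).trans (d_iCycles _ _ _ _))
  have hz' : (HomologicalComplex.cyclesMap (torComplexMap M f) (i + j)).hom z =
      cyclesMul M N μ (ν.compr₂ f.hom) i j (i + j) rfl a b := by
    apply (ModuleCat.mono_iff_injective ((torComplex M N).iCycles (i + j))).1 inferInstance
    refine (congrArg (fun g => g.hom z)
      (HomologicalComplex.cyclesMap_i (torComplexMap M f) (i + j))).trans ?_
    exact (congrArg ((torComplexMap M f).f (i + j)).hom hz).trans hc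
  rw [← hz']
  refine (congrArg (fun g => g.hom z)
    (HomologicalComplex.homologyπ_naturality (torComplexMap M f) (i + j))).symm.trans ?_
  rw [h]
  rfl

/-- The product of `I ^ s` with values in `I ^ (s + 1)`, for `s` positive. -/
def powMulSucc (I : Ideal R) {s : ℕ} (hs : 1 ≤ s) :
    powMod I s →ₗ[R] powMod I s →ₗ[R] powMod I (s + 1) :=
  LinearMap.mk₂ R (fun a b => ⟨(a : R) * (b : R), Ideal.pow_le_pow_right (by omega)
      (pow_add I s s ▸ Ideal.mul_mem_mul a.2 b.2)⟩)
    (fun _ _ _ => Subtype.ext (add_mul _ _ _)) (fun _ _ _ => Subtype.ext (mul_assoc _ _ _))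
    (fun _ _ _ => Subtype.ext (mul_add _ _ _)) (fun _ _ _ => Subtype.ext (mul_left_comm _ _ _))

lemma torPowMul_eq_zero (hx : IsWeaklyRegular x n) {s : ℕ} (hs : 1 ≤ s) (i j : ℕ) :
    torPowMul (idealOf x n) s i j = 0 :=
  torMul_eq_zero (ModuleCat.of R (R ⧸ idealOf x n)) (LinearMap.mul R (R ⧸ idealOf x n))
    (powIncl (idealOf x n) s)
    (Submodule.inclusion_injective (Ideal.pow_le_pow_right (Nat.le_succ s)))
    (powMulSucc (idealOf x n) hs) i j
    (homologyMap_torComplexMap_powIncl hx s (i + j))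

end IdealTor

end
theorem mainTheorem3 {R : Type*} [CommRing R] (rs : List R)
    (hrs : RingTheory.Sequence.IsRegular R rs) (I : Ideal R) (hI : I = Ideal.ofList rs) (s : ℕ) :
    (∀ k : ℕ, Function.Injective (IdealTor.torPowProj I s k).hom) ∧
    Function.Surjective (IdealTor.torPowProj I s 0).hom ∧
    (∀ k : ℕ, Function.Exact (IdealTor.torPowProj I s (k + 1)).hom (IdealTor.torPowδ I s k).hom) ∧
    (∀ k : ℕ, Module.Free (R ⧸ I)
      (IdealTor.tor k (ModuleCat.of R (R ⧸ I)) (IdealTor.powMod I s))) ∧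
    (1 ≤ s → ∀ i j : ℕ, IdealTor.torPowMul I s i j = 0) := by
  have hx := Koszul.isWeaklyRegular_getD hrs.toIsWeaklyRegular
  obtain rfl : I = Koszul.idealOf (fun j => rs.getD j 0) rs.length := by
    rw [hI, ← min_self rs.length, ← Koszul.ofList_eq_idealOf, List.take_length]
  exact ⟨IdealTor.torPowProj_injective hx s,
    IdealTor.torMap_zero_surjective _ _ (Submodule.mkQ_surjective _),
    IdealTor.torPowδ_exact hx s, IdealTor.free_tor_powMod hx s,
    fun hs => IdealTor.torPowMul_eq_zero hx hs⟩
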